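/- **Setting.** Let $\mathfrak X$ be a compact metric space, $F$ (the data distribution) and $H$ (the base measure) Borel probability measures on $\mathfrak X$, and $a>0$. Let $k:\mathfrak X\times\mathfrak X\to\mathbb R$ be a continuous reproducing kernel with $|k(t,t')|<K$ for all $t,t'$, whose reproducing kernel Hilbert space $\mathcal H_k$ is universal (dense in $C(\mathfrak X)$ for the uniform norm). For probability measures $\mu,\nu$ on $\mathfrak X$ put $$\mathrm W(\mu,\nu)=\sup_{D\ 1\text{-Lipschitz}}\big(E_\mu D-E_\nu D\big),\qquad \mathrm{MMD}(\mu,\nu)=\sup_{\|h\|_{\mathcal H_k}\le 1}\big(E_\mu h-E_\nu h\big),\qquad \mathrm{WMMD}=\mathrm W+\mathrm{MMD}.$$ Let $\Omega\subset\mathbb R^{t}$ be compact and let $Gen_\omega:\mathbb R^p\to\mathfrak X$ $(\omega\in\Omega)$ be a family of generators with $(\omega,z)\mapsto Gen_\omega(z)$ continuous. Let $\nu$ be a probability measure on $\mathbb R^p$ (the noise distribution, e.g. standard Gaussian), and let $F_{Gen_\omega}$ be the law of $Gen_\omega(Z)$, $Z\sim\nu$. For $n,N\ge1$ let the data $X_1,\dots,X_n$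 be i.i.d. from $F$, with empirical distribution $F_{X_{1:n}}$, and let $$H^*=\tfrac{a}{a+n}H+\tfrac{n}{a+n}F_{X_{1:n}}$$ be the base measure of the posterior $DP(a+n,H^*)$ of the Dirichlet process prior $DP(a,H)$. Let $$F^{\mathrm{pos}}_N=\sum_{i=1}^N J_{i,N}\,\delta_{X_i^{\mathrm{pos}}}$$ be its finite approximation: given the data, $X^{\mathrm{pos}}_1,\dots,X^{\mathrm{pos}}_N$ are i.i.d. from $H^*$, and $(J_{1,N},\dots,J_{N,N})\sim\mathrm{Dir}(\frac{a+n}N,\dots,\frac{a+n}N)$ is independent of the data and of the $X^{\mathrm{pos}}_i$. Let $Z_1,\dots,Z_N$ be i.i.d. from $\nu$, independent of all the rest, and let $F_{Gen_\omega(Z_{1:N})}$ be the empirical distribution of $Gen_\omega(Z_1),\dots,Gen_\omega(Z_N)$. **Theorem.** Assume that the model is well specified: there is $\omega_{\mathrm{True}}\in\Omega$ with $\mathrm{WMMD}(F,F_{Gen_{\omega_{\mathrm{True}}}})=0$. Assume also that there is a finite $M$ such that, almost surely, $\max\big(\mathrm W(F,F_{X_{1:n}}),\mathrm W(F,H^*)\big)<M$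 for all $n\ge1$. For all $n,N\ge1$ let $\omega^\star=\omega^\star_{\mathrm{BNPL}}$ be a random element of $\Omega$ that almost surely minimizes over $\omega\in\Omega$ the posterior WMMD, where the posterior WMMD is (for all $n,N$) either $\mathrm{WMMD}(F^{\mathrm{pos}}_N,F_{Gen_\omega})$ or its version $\mathrm{WMMD}(F^{\mathrm{pos}}_N,F_{Gen_\omega(Z_{1:N})})$ computed from generated samples. Then, in either case, $\mathrm{WMMD}(F,F_{Gen_{\omega^\star}})$ is integrable for all $n,N\ge1$, and $$\limsup_{n,N\to\infty}E\big[\mathrm{WMMD}(F,F_{Gen_{\omega^\star}})\big]=0,$$ where $n,N\to\infty$ jointly and without any relation between them. -/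

import Mathlib

open MeasureTheory ProbabilityTheory Filter Topology
open scoped ENNReal

noncomputable section

namespace BNPL

/-! ### The distances -/

section Distances

variable {𝔛 : Type*} [MetricSpace 𝔛] [MeasurableSpace 𝔛]

/-- The Wasserstein distance in its Kantorovich-Rubinstein form,
`W(μ, ν) = sup (E_μ D - E_ν D)` over all `1`-Lipschitz functions `D : 𝔛 → ℝ`.
It is used for probability measures on a compact metric space, where the supremum is over a set of
numbers bounded by the diameter. -/
def wasserstein (μ ν : Measure 𝔛) : ℝ :=
  ⨆ D : {D : 𝔛 → ℝ // LipschitzWith 1 D}, ((∫ x, D.1 x ∂μ) - ∫ x, D.1 x ∂ν)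

/-- The maximum mean discrepancy: the supremum of `E_μ h - E_ν h` over the closed unit ball of the
reproducing kernel Hilbert space `ℋ`. -/
def mmd (ℋ : Type*) [NormedAddCommGroup ℋ] [InnerProductSpace ℝ ℋ] [RKHS ℝ ℋ 𝔛 ℝ]
    (μ ν : Measure 𝔛) : ℝ :=
  ⨆ h : Metric.closedBall (0 : ℋ) 1, ((∫ x, h.1 x ∂μ) - ∫ x, h.1 x ∂ν)

/-- The combined distance `WMMD = W + MMD`. -/
def wmmd (ℋ : Type*) [NormedAddCommGroup ℋ] [InnerProductSpace ℝ ℋ] [RKHS ℝ ℋ 𝔛 ℝ]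
    (μ ν : Measure 𝔛) : ℝ :=
  wasserstein μ ν + mmd ℋ μ ν

end Distances

/-- `ℋ` is the reproducing kernel Hilbert space of the real-valued kernel `k`. (Mathlib's kernel of
an RKHS is operator-valued; for scalar functions it is multiplication by the number `k x y`.) -/
def IsKernelOf {𝔛 : Type*} (k : 𝔛 → 𝔛 → ℝ) (ℋ : Type*) [NormedAddCommGroup ℋ]
    [InnerProductSpace ℝ ℋ] [CompleteSpace ℋ] [RKHS ℝ ℋ 𝔛 ℝ] : Prop :=
  ∀ x y, RKHS.kernel ℋ x y 1 = k x y

/-- An RKHS over a compact space is universal if it is dense, for the uniform norm, in the space of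
continuous functions. (Its elements are continuous when its kernel is.) -/
def IsUniversal {𝔛 : Type*} [TopologicalSpace 𝔛] (ℋ : Type*) [NormedAddCommGroup ℋ]
    [InnerProductSpace ℝ ℋ] [RKHS ℝ ℋ 𝔛 ℝ] : Prop :=
  ∀ g : C(𝔛, ℝ), ∀ ε > 0, ∃ h : ℋ, ∀ x, |h x - g x| < ε

/-! ### Discrete measures, the posterior base measure, the Dirichlet distribution -/

section Sampling

variable {𝔛 : Type*} [MeasurableSpace 𝔛]

/-- `∑ i, J i δ_{x i}`. -/
def discreteMeasure {N : ℕ} (J : Fin N → ℝ) (x : Fin N → 𝔛) : Measure 𝔛 :=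
  ∑ i, ENNReal.ofReal (J i) • Measure.dirac (x i)

/-- The empirical distribution `(1/n) ∑ i, δ_{x i}`. -/
def empirical {n : ℕ} (x : Fin n → 𝔛) : Measure 𝔛 :=
  discreteMeasure (fun _ => 1 / (n : ℝ)) x

/-- The base measure `H* = a/(a+n) H + n/(a+n) F_{x_{1:n}}` of the posterior of the Dirichlet
process `DP(a, H)` given the data `x_{1:n}`; this posterior is `DP(a + n, H*)`. -/
def posteriorBase (a : ℝ) (H : Measure 𝔛) {n : ℕ} (x : Fin n → 𝔛) : Measure 𝔛 :=
  ENNReal.ofReal (a / (a + n)) • H + ENNReal.ofReal (n / (a + n)) • empirical x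

/-- The Dirichlet distribution with parameters `α i > 0`: the law of the normalised vector
`Γ i / ∑ j, Γ j` of independent Gamma variables `Γ i ∼ Gamma(α i, 1)`. -/
def dirichlet {ι : Type*} [Fintype ι] (α : ι → ℝ) : Measure (ι → ℝ) :=
  (Measure.pi fun i => gammaMeasure (α i) 1).map fun g i => g i / ∑ j, g j

instance {N : ℕ} (J : Fin N → ℝ) (x : Fin N → 𝔛) : IsFiniteMeasure (discreteMeasure J x) where
  measure_univ_lt_top := by
    simp [discreteMeasure, ENNReal.sum_lt_top]

instance (a : ℝ) (H : Measure 𝔛) [IsFiniteMeasure H] {n : ℕ} (x : Fin n → 𝔛) :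
    IsFiniteMeasure (posteriorBase a H x) where
  measure_univ_lt_top := by
    have h : (empirical x) Set.univ < ∞ := measure_lt_top (discreteMeasure _ x) _
    simp only [posteriorBase, Measure.add_apply, Measure.smul_apply, smul_eq_mul]
    exact ENNReal.add_lt_top.2 ⟨ENNReal.mul_lt_top ENNReal.ofReal_lt_top (measure_lt_top H _),
      ENNReal.mul_lt_top ENNReal.ofReal_lt_top h⟩

theorem measurable_posteriorBase_apply (a : ℝ) (H : Measure 𝔛) (n : ℕ) {s : Set 𝔛}
    (hs : MeasurableSet s) : Measurable fun x : Fin n → 𝔛 => posteriorBase a H x s := by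
  simp only [posteriorBase, empirical, discreteMeasure, Measure.add_apply, Measure.smul_apply,
    Measure.finsetSum_apply, smul_eq_mul]
  refine measurable_const.add (Measurable.const_mul (Finset.measurable_sum _ fun i _ => ?_) _)
  exact Measurable.const_mul
    ((Measure.measurable_coe hs).comp (Measure.measurable_dirac.comp (measurable_pi_apply i))) _

theorem measurable_pi_posteriorBase (a : ℝ) (H : Measure 𝔛) [IsFiniteMeasure H] (n N : ℕ) :
    Measurable fun x : Fin n → 𝔛 => Measure.pi fun _ : Fin N => posteriorBase a H x := by
  refine Measurable.measure_of_isPiSystem generateFrom_pi.symm isPiSystem_pi ?_ ?_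
  · rintro _ ⟨t, ht, rfl⟩
    simp only [Measure.pi_pi]
    exact Finset.measurable_prod _ fun i _ =>
      measurable_posteriorBase_apply a H n (ht i (Set.mem_univ i))
  · simp only [Measure.pi_univ]
    exact Finset.measurable_prod _ fun i _ =>
      measurable_posteriorBase_apply a H n MeasurableSet.univ

/-- The kernel sending the data `x_{1:n}` to the law of `N` independent draws from `H*`. -/
def posteriorDraws (a : ℝ) (H : Measure 𝔛) [IsFiniteMeasure H] (n N : ℕ) :
    Kernel (Fin n → 𝔛) (Fin N → 𝔛) :=
  ⟨fun x => Measure.pi fun _ : Fin N => posteriorBase a H x, measurable_pi_posteriorBase a H n N⟩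

/-- The joint law of `((X_{1:n}, Xpos_{1:N}), (J_{1:N}, Z_{1:N}))`, where
* the data `X_{1:n}` are i.i.d. from `F`;
* given the data, the atoms `Xpos_{1:N}` are i.i.d. from `H*`;
* the weights `J_{1:N}` are `Dir((a+n)/N, …, (a+n)/N)`, independent of data and atoms;
* the noise inputs `Z_{1:N}` are i.i.d. from `ν`, independent of all the rest. -/
def sampleLaw {E : Type*} [MeasurableSpace E] (F H : Measure 𝔛) [IsFiniteMeasure H] (a : ℝ)
    (ν : Measure E) (n N : ℕ) :
    Measure (((Fin n → 𝔛) × (Fin N → 𝔛)) × ((Fin N → ℝ) × (Fin N → E))) :=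
  ((Measure.pi fun _ : Fin n => F) ⊗ₘ posteriorDraws a H n N).prod
    ((dirichlet fun _ : Fin N => (a + n) / N).prod (Measure.pi fun _ : Fin N => ν))

end Sampling

end BNPL

end

/-! Write `φ x` for the kernel section at `x`. Both suprema in `wmmd` run over functions whose
oscillation is at most `modulus ℋ x y = dist x y + ‖φ x - φ y‖`, a continuous pseudometric on a
compact space. On a small enough cell all these test functions are nearly constant simultaneously.
Hence finitely many cells give `WMMD(μ, ν) ≤ ε + c ∑ (μ(A_i) - ν(A_i))²`, and for images under `Gen
ω` the cells can be chosen in the noise space uniformly in `ω`, because `Ω` is compact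
(`exists_cells_wmmd_le_sum_sq`).

It remains to bound mean squares of cell masses. Given data and weights, the mass that the
approximate posterior gives a cell deviates from its `H*`-mass with mean square at most `∑ J_i²`,
whose Dirichlet expectation is at most `4/N + 8/(a+n)`. The `H*`-mass deviates from the `F`-mass
with mean square `O(1/n)`, and the generated samples contribute `1/N`
(`lintegral_sq_posterior_sub_le`, `lintegral_sq_noise_sub_le`).

By the triangle inequality, a minimiser is no worse than twice the data error plus twice the
sampling error (`wmmd_le_of_minimiser`). So the expected distance is at most `ε + c_ε (1/n + 1/N)`,
which forces the joint limit. -/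

namespace BNPL

/-! ### Test functions and the metric properties of WMMD -/

section Distances

variable {𝔛 : Type*} [MetricSpace 𝔛] {ℋ : Type*} [NormedAddCommGroup ℋ] [InnerProductSpace ℝ ℋ]
  [CompleteSpace ℋ] [RKHS ℝ ℋ 𝔛 ℝ]

omit [MetricSpace 𝔛] in
theorem norm_kerFun_sub_sq {k : 𝔛 → 𝔛 → ℝ} (hk : IsKernelOf k ℋ) (x y : 𝔛) :
    ‖RKHS.kerFun ℋ x (1 : ℝ) - RKHS.kerFun ℋ y (1 : ℝ)‖ ^ 2 = k x x - 2 * k y x + k y y := by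
  have h : ∀ u v : 𝔛, inner ℝ (RKHS.kerFun ℋ u (1 : ℝ)) (RKHS.kerFun ℋ v (1 : ℝ)) = k v u := by
    intro u v
    rw [← RKHS.kernel_inner, hk]
    simp
  rw [norm_sub_sq_real, ← real_inner_self_eq_norm_sq, ← real_inner_self_eq_norm_sq, h, h, h]

/-- The norm of the difference of two kernel sections is the square root of an expression in `k`
that is continuous and vanishes on the diagonal. -/
theorem continuous_kerFun {k : 𝔛 → 𝔛 → ℝ} (hk_cont : Continuous fun q : 𝔛 × 𝔛 => k q.1 q.2)
    (hk : IsKernelOf k ℋ) : Continuous fun x : 𝔛 => RKHS.kerFun ℋ x (1 : ℝ) := by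
  refine continuous_iff_continuousAt.2 fun y => ?_
  rw [ContinuousAt, tendsto_iff_norm_sub_tendsto_zero]
  have h : ∀ x : 𝔛, ‖RKHS.kerFun ℋ x (1 : ℝ) - RKHS.kerFun ℋ y (1 : ℝ)‖ =
      √(k x x - 2 * k y x + k y y) := fun x => by
    rw [← norm_kerFun_sub_sq hk, Real.sqrt_sq (norm_nonneg _)]
  simp only [h]
  have h1 : Continuous fun x => k x x := hk_cont.comp (continuous_id.prodMk continuous_id)
  have h2 : Continuous fun x => k y x := hk_cont.comp (continuous_const.prodMk continuous_id)
  have h3 : Continuous fun x => √(k x x - 2 * k y x + k y y) := by fun_prop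
  have h4 := h3.tendsto y
  rwa [show k y y - 2 * k y y + k y y = 0 by ring, Real.sqrt_zero] at h4

-- Reproducing property and Cauchy–Schwarz.
omit [MetricSpace 𝔛] in
theorem abs_apply_sub_apply_le (h : ℋ) (x y : 𝔛) :
    |h x - h y| ≤ ‖h‖ * ‖RKHS.kerFun ℋ x (1 : ℝ) - RKHS.kerFun ℋ y (1 : ℝ)‖ := by
  have e : ∀ u : 𝔛, h u = inner ℝ h (RKHS.kerFun ℋ u (1 : ℝ)) := fun u => by simp
  rw [e x, e y, ← inner_sub_right]
  exact abs_real_inner_le_norm _ _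

variable (ℋ) in
/-- A pseudometric on `𝔛` that dominates the oscillation of all `1`-Lipschitz functions and of all
elements of the unit ball of `ℋ`. -/
noncomputable def modulus (x y : 𝔛) : ℝ :=
  dist x y + ‖RKHS.kerFun ℋ x (1 : ℝ) - RKHS.kerFun ℋ y (1 : ℝ)‖

variable (ℋ) in
/-- The functions whose oscillation is controlled by `modulus`. -/
def IsTest (g : 𝔛 → ℝ) : Prop := ∀ x y, |g x - g y| ≤ modulus ℋ x y

theorem modulus_self (x : 𝔛) : modulus ℋ x x = 0 := by simp [modulus]

theorem modulus_nonneg (x y : 𝔛) : 0 ≤ modulus ℋ x y := by unfold modulus; positivity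

theorem isTest_of_lipschitzWith {D : 𝔛 → ℝ} (hD : LipschitzWith 1 D) : IsTest ℋ D := by
  intro x y
  have := hD.dist_le_mul x y
  rw [Real.dist_eq, NNReal.coe_one, one_mul] at this
  exact this.trans (le_add_of_nonneg_right (norm_nonneg _))

theorem isTest_of_mem_closedBall {h : ℋ} (hh : h ∈ Metric.closedBall (0 : ℋ) 1) :
    IsTest ℋ (fun x : 𝔛 => h x) := by
  intro x y
  rw [mem_closedBall_zero_iff] at hh
  calc |h x - h y| ≤ ‖h‖ * ‖RKHS.kerFun ℋ x (1 : ℝ) - RKHS.kerFun ℋ y (1 : ℝ)‖ :=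
        abs_apply_sub_apply_le h x y
    _ ≤ 1 * ‖RKHS.kerFun ℋ x (1 : ℝ) - RKHS.kerFun ℋ y (1 : ℝ)‖ := by gcongr
    _ ≤ _ := by rw [one_mul]; exact le_add_of_nonneg_left dist_nonneg

theorem continuous_modulus (hφ : Continuous fun x : 𝔛 => RKHS.kerFun ℋ x (1 : ℝ)) :
    Continuous fun q : 𝔛 × 𝔛 => modulus ℋ q.1 q.2 := by
  unfold modulus
  exact (continuous_fst.dist continuous_snd).add
    ((hφ.comp continuous_fst).sub (hφ.comp continuous_snd)).norm

theorem exists_modulus_le [CompactSpace 𝔛]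
    (hφ : Continuous fun x : 𝔛 => RKHS.kerFun ℋ x (1 : ℝ)) :
    ∃ B : ℝ, 0 ≤ B ∧ ∀ x y : 𝔛, modulus ℋ x y ≤ B := by
  obtain ⟨B, hB⟩ := (isCompact_range (continuous_modulus hφ)).bddAbove
  exact ⟨max B 0, le_max_right _ _, fun x y => (hB ⟨(x, y), rfl⟩).trans (le_max_left _ _)⟩

theorem IsTest.continuous {g : 𝔛 → ℝ} (hg : IsTest ℋ g)
    (hφ : Continuous fun x : 𝔛 => RKHS.kerFun ℋ x (1 : ℝ)) : Continuous g := by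
  refine continuous_iff_continuousAt.2 fun y => ?_
  rw [ContinuousAt, tendsto_iff_norm_sub_tendsto_zero]
  have h : Tendsto (fun x => modulus ℋ x y) (𝓝 y) (𝓝 0) := by
    rw [← modulus_self (ℋ := ℋ) y]
    exact ((continuous_modulus hφ).comp (continuous_id.prodMk continuous_const)).tendsto y
  exact squeeze_zero (fun _ => norm_nonneg _) (fun x => hg x y) h

variable [MeasurableSpace 𝔛]

/-- Both families of competitors consist of test functions; the factor 2 counts the summands W and
MMD. -/
theorem wmmd_le_of_isTest {μ ν : Measure 𝔛} {r : ℝ}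
    (h : ∀ g : 𝔛 → ℝ, IsTest ℋ g → (∫ x, g x ∂μ) - ∫ x, g x ∂ν ≤ r) :
    wmmd ℋ μ ν ≤ 2 * r := by
  have : Nonempty {D : 𝔛 → ℝ // LipschitzWith 1 D} :=
    ⟨⟨fun _ => 0, (LipschitzWith.const' 0)⟩⟩
  have : Nonempty (Metric.closedBall (0 : ℋ) 1) := ⟨⟨0, by simp⟩⟩
  have h1 : wasserstein μ ν ≤ r := ciSup_le fun D => h _ (isTest_of_lipschitzWith D.2)
  have h2 : mmd ℋ μ ν ≤ r := ciSup_le fun D => h _ (isTest_of_mem_closedBall D.2)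
  unfold wmmd
  linarith

-- The zero function competes in both suprema. An unbounded real `iSup` is `0` by convention, so
-- arbitrary measures are allowed.
omit [CompleteSpace ℋ] in
theorem wmmd_nonneg (μ ν : Measure 𝔛) : 0 ≤ wmmd ℋ μ ν := by
  refine add_nonneg (Real.iSup_nonneg' ⟨⟨fun _ => 0, LipschitzWith.const' 0⟩, by simp⟩)
    (Real.iSup_nonneg' ⟨⟨0, by simp⟩, by simp⟩)

theorem wmmd_self (μ : Measure 𝔛) : wmmd ℋ μ μ = 0 := by
  refine le_antisymm ?_ (wmmd_nonneg μ μ)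
  have := wmmd_le_of_isTest (ℋ := ℋ) (μ := μ) (ν := μ) (r := 0) fun g _ => by simp
  simpa using this

-- Negation permutes each family of competitors. Reindexing the suprema this way needs no
-- boundedness.
omit [CompleteSpace ℋ] in
theorem wmmd_comm (μ ν : Measure 𝔛) : wmmd ℋ μ ν = wmmd ℋ ν μ := by
  let e : {D : 𝔛 → ℝ // LipschitzWith 1 D} ≃ {D : 𝔛 → ℝ // LipschitzWith 1 D} :=
    { toFun := fun D => ⟨fun x => -D.1 x, D.2.neg⟩
      invFun := fun D => ⟨fun x => -D.1 x, D.2.neg⟩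
      left_inv := fun D => by simp
      right_inv := fun D => by simp }
  let e' : Metric.closedBall (0 : ℋ) 1 ≃ Metric.closedBall (0 : ℋ) 1 :=
    { toFun := fun h => ⟨-h.1, by simpa using mem_closedBall_zero_iff.1 h.2⟩
      invFun := fun h => ⟨-h.1, by simpa using mem_closedBall_zero_iff.1 h.2⟩
      left_inv := fun h => by simp
      right_inv := fun h => by simp }
  have h1 : wasserstein μ ν = wasserstein ν μ := by
    unfold wasserstein
    rw [← e.iSup_comp]
    refine iSup_congr fun D => ?_
    simp only [e, Equiv.coe_fn_mk, integral_neg]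
    ring
  have h2 : mmd ℋ μ ν = mmd ℋ ν μ := by
    unfold mmd
    rw [← e'.iSup_comp]
    refine iSup_congr fun D => ?_
    simp only [e', Equiv.coe_fn_mk, RKHS.coe_neg, Pi.neg_apply, integral_neg]
    ring
  rw [wmmd, wmmd, h1, h2]

variable [BorelSpace 𝔛] [CompactSpace 𝔛]

theorem IsTest.integrable {g : 𝔛 → ℝ} (hg : IsTest ℋ g)
    (hφ : Continuous fun x : 𝔛 => RKHS.kerFun ℋ x (1 : ℝ)) (μ : Measure 𝔛) [IsFiniteMeasure μ] :
    Integrable g μ :=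
  (BoundedContinuousFunction.mkOfCompact ⟨g, hg.continuous hφ⟩).integrable μ

/-- Compare both integrals with the value at one point. The crude constant suffices: its use is to
make the suprema over competitors bounded. -/
theorem IsTest.integral_sub_le {g : 𝔛 → ℝ} (hg : IsTest ℋ g)
    (hφ : Continuous fun x : 𝔛 => RKHS.kerFun ℋ x (1 : ℝ)) {B : ℝ}
    (hB : ∀ x y : 𝔛, modulus ℋ x y ≤ B) (μ ν : Measure 𝔛) [IsProbabilityMeasure μ]
    [IsProbabilityMeasure ν] : (∫ x, g x ∂μ) - ∫ x, g x ∂ν ≤ 2 * B := by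
  obtain ⟨x₀⟩ : Nonempty 𝔛 := nonempty_of_isProbabilityMeasure μ
  have h1 : ∫ x, g x ∂μ ≤ g x₀ + B := by
    have := integral_mono (hg.integrable hφ μ) (integrable_const (g x₀ + B)) (fun x => by
      have := (abs_le.1 ((hg x x₀).trans (hB _ _))).2
      simp only
      linarith)
    simpa using this
  have h2 : g x₀ - B ≤ ∫ x, g x ∂ν := by
    have := integral_mono (integrable_const (g x₀ - B)) (hg.integrable hφ ν) (fun x => by
      have := (abs_le.1 ((hg x x₀).trans (hB _ _))).1
      simp only
      linarith)
    simpa using this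
  linarith

theorem wmmd_triangle (hφ : Continuous fun x : 𝔛 => RKHS.kerFun ℋ x (1 : ℝ))
    (μ₁ μ₂ μ₃ : Measure 𝔛) [IsProbabilityMeasure μ₁] [IsProbabilityMeasure μ₂]
    [IsProbabilityMeasure μ₃] : wmmd ℋ μ₁ μ₃ ≤ wmmd ℋ μ₁ μ₂ + wmmd ℋ μ₂ μ₃ := by
  obtain ⟨B, -, hB⟩ := exists_modulus_le hφ
  have b1 : ∀ μ ν : Measure 𝔛, IsProbabilityMeasure μ → IsProbabilityMeasure ν →
      BddAbove (Set.range fun D : {D : 𝔛 → ℝ // LipschitzWith 1 D} =>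
        (∫ x, D.1 x ∂μ) - ∫ x, D.1 x ∂ν) := by
    rintro μ ν _ _
    refine ⟨2 * B, ?_⟩
    rintro _ ⟨D, rfl⟩
    exact (isTest_of_lipschitzWith (ℋ := ℋ) D.2).integral_sub_le hφ hB μ ν
  have b2 : ∀ μ ν : Measure 𝔛, IsProbabilityMeasure μ → IsProbabilityMeasure ν →
      BddAbove (Set.range fun h : Metric.closedBall (0 : ℋ) 1 =>
        (∫ x, h.1 x ∂μ) - ∫ x, h.1 x ∂ν) := by
    rintro μ ν _ _
    refine ⟨2 * B, ?_⟩
    rintro _ ⟨D, rfl⟩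
    exact (isTest_of_mem_closedBall D.2).integral_sub_le hφ hB μ ν
  have : Nonempty {D : 𝔛 → ℝ // LipschitzWith 1 D} := ⟨⟨fun _ => 0, (LipschitzWith.const' 0)⟩⟩
  have : Nonempty (Metric.closedBall (0 : ℋ) 1) := ⟨⟨0, by simp⟩⟩
  have h1 : wasserstein μ₁ μ₃ ≤ wasserstein μ₁ μ₂ + wasserstein μ₂ μ₃ := by
    refine ciSup_le fun D => ?_
    have := add_le_add (le_ciSup (b1 μ₁ μ₂ ‹_› ‹_›) D) (le_ciSup (b1 μ₂ μ₃ ‹_› ‹_›) D)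
    unfold wasserstein
    linarith
  have h2 : mmd ℋ μ₁ μ₃ ≤ mmd ℋ μ₁ μ₂ + mmd ℋ μ₂ μ₃ := by
    refine ciSup_le fun D => ?_
    have := add_le_add (le_ciSup (b2 μ₁ μ₂ ‹_› ‹_›) D) (le_ciSup (b2 μ₂ μ₃ ‹_› ‹_›) D)
    unfold mmd
    linarith
  unfold wmmd
  linarith

/-- If `μ.map f` and `μ.map g` are compared along `f` and `g`, the distance is at most the mean of
the modulus. -/
theorem wmmd_map_le (hφ : Continuous fun x : 𝔛 => RKHS.kerFun ℋ x (1 : ℝ)) {E : Type*}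
    [MeasurableSpace E] (μ : Measure E) [IsProbabilityMeasure μ] {f g : E → 𝔛} (hf : Measurable f)
    (hg : Measurable g) : wmmd ℋ (μ.map f) (μ.map g) ≤ 2 * ∫ z, modulus ℋ (f z) (g z) ∂μ := by
  obtain ⟨B, -, hB⟩ := exists_modulus_le hφ
  refine wmmd_le_of_isTest fun D hD => ?_
  have hc := hD.continuous hφ
  have hi : ∀ {f : E → 𝔛}, Measurable f → Integrable (fun z => D (f z)) μ := fun {f} hf => by
    have : IsProbabilityMeasure (μ.map f) := Measure.isProbabilityMeasure_map hf.aemeasurable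
    exact (hD.integrable hφ (μ.map f)).comp_measurable hf
  rw [integral_map hf.aemeasurable hc.aestronglyMeasurable,
    integral_map hg.aemeasurable hc.aestronglyMeasurable, ← integral_sub (hi hf) (hi hg)]
  refine integral_mono ((hi hf).sub (hi hg)) ?_ fun z => (le_abs_self _).trans (hD _ _)
  refine Integrable.of_bound (C := B) ?_ (ae_of_all _ fun z => ?_)
  · exact (((continuous_modulus hφ).measurable).comp (hf.prodMk hg)).aestronglyMeasurable
  · rw [Real.norm_of_nonneg (modulus_nonneg _ _)]
    exact hB _ _

end Distances

/-! ### Reduction of WMMD to the masses of finitely many cells -/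

section Cells

/-- The step function with values `c i` is within `ε` of `f` on the cells and vanishes off them,
where the error is at most `B`. -/
theorem abs_integral_sub_integral_sum_indicator_le {E ι : Type*} [MeasurableSpace E] [Fintype ι]
    {A : ι → Set E} (hA : ∀ i, MeasurableSet (A i)) (hd : Pairwise (Function.onFun Disjoint A))
    {f : E → ℝ} (hf : Measurable f) {c : ι → ℝ} {B ε : ℝ} (hε : 0 ≤ ε)
    (hfB : ∀ e, |f e| ≤ B) (hfc : ∀ i, ∀ e ∈ A i, |f e - c i| ≤ ε)
    (μ : Measure E) [IsProbabilityMeasure μ] :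
    |(∫ e, f e ∂μ) - ∑ i, c i * μ.real (A i)| ≤ ε + B * μ.real (⋃ i, A i)ᶜ := by
  have hR : MeasurableSet (⋃ i, A i)ᶜ := (MeasurableSet.iUnion hA).compl
  have hs : ∫ e, ∑ i, (A i).indicator (fun _ => c i) e ∂μ = ∑ i, c i * μ.real (A i) := by
    rw [integral_finsetSum _ fun i _ => (integrable_const _).indicator (hA i)]
    refine Finset.sum_congr rfl fun i _ => ?_
    rw [integral_indicator_const _ (hA i), smul_eq_mul, mul_comm]
  have hfi : Integrable f μ := Integrable.of_bound hf.aestronglyMeasurable B (ae_of_all _ hfB)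
  have hsi : Integrable (fun e => ∑ i, (A i).indicator (fun _ => c i) e) μ :=
    integrable_finsetSum _ fun i _ => (integrable_const _).indicator (hA i)
  have hb : ∀ e, |f e - ∑ i, (A i).indicator (fun _ => c i) e| ≤
      ε + (⋃ i, A i)ᶜ.indicator (fun _ => B) e := by
    intro e
    by_cases he : e ∈ ⋃ i, A i
    · obtain ⟨i, hi⟩ := Set.mem_iUnion.1 he
      rw [Finset.sum_eq_single i, Set.indicator_of_mem hi,
        Set.indicator_of_notMem (by simpa using he),
        add_zero]
      · exact hfc i e hi
      · intro j _ hj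
        exact Set.indicator_of_notMem (fun h => (hd hj).le_bot ⟨h, hi⟩) _
      · simp
    · rw [Finset.sum_eq_zero, Set.indicator_of_mem (by simpa using he), sub_zero]
      · linarith [hfB e]
      · intro j _
        exact Set.indicator_of_notMem (fun h => he (Set.mem_iUnion.2 ⟨j, h⟩)) _
  have hbi : Integrable (fun e => (⋃ i, A i)ᶜ.indicator (fun _ => B) e) μ :=
    (integrable_const B).indicator hR
  rw [← hs, ← integral_sub hfi hsi]
  calc |∫ e, f e - ∑ i, (A i).indicator (fun _ => c i) e ∂μ|
      ≤ ∫ e, |f e - ∑ i, (A i).indicator (fun _ => c i) e| ∂μ := abs_integral_le_integral_abs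
    _ ≤ ∫ e, (ε + (⋃ i, A i)ᶜ.indicator (fun _ => B) e) ∂μ :=
        integral_mono (hfi.sub hsi).abs ((integrable_const _).add hbi) hb
    _ = ε + B * μ.real (⋃ i, A i)ᶜ := by
        rw [integral_add (integrable_const _) hbi, integral_indicator_const _ hR]
        simp [mul_comm]

/-- Two probability measures integrate alike a function that is nearly constant on finitely many
cells of nearly equal masses. -/
theorem integral_sub_integral_le_of_cells {E ι : Type*} [MeasurableSpace E] [Fintype ι]
    {A : ι → Set E} (hA : ∀ i, MeasurableSet (A i)) (hd : Pairwise (Function.onFun Disjoint A))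
    {f : E → ℝ} (hf : Measurable f) {c : ι → ℝ} {B ε : ℝ} (hε : 0 ≤ ε) (hB : 0 ≤ B)
    (hfB : ∀ e, |f e| ≤ B) (hcB : ∀ i, |c i| ≤ B) (hfc : ∀ i, ∀ e ∈ A i, |f e - c i| ≤ ε)
    (μ ν : Measure E) [IsProbabilityMeasure μ] [IsProbabilityMeasure ν] :
    (∫ e, f e ∂μ) - ∫ e, f e ∂ν ≤ 2 * ε + 2 * B * ν.real (⋃ i, A i)ᶜ +
      B * (|μ.real (⋃ i, A i)ᶜ - ν.real (⋃ i, A i)ᶜ| + ∑ i, |μ.real (A i) - ν.real (A i)|) := by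
  have h1 := (abs_le.1 (abs_integral_sub_integral_sum_indicator_le hA hd hf hε hfB hfc μ)).2
  have h2 := (abs_le.1 (abs_integral_sub_integral_sum_indicator_le hA hd hf hε hfB hfc ν)).1
  have h3 : (∑ i, c i * μ.real (A i)) - ∑ i, c i * ν.real (A i) ≤
      B * ∑ i, |μ.real (A i) - ν.real (A i)| := by
    rw [← Finset.sum_sub_distrib, Finset.mul_sum]
    refine Finset.sum_le_sum fun i _ => ?_
    rw [← mul_sub]
    refine (le_abs_self _).trans ?_
    rw [abs_mul]
    exact mul_le_mul_of_nonneg_right (hcB i) (abs_nonneg _)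
  -- The leftover mass of `μ` is traded for that of `ν`, so that tightness of `ν` alone will be
  -- enough.
  have h4 : B * μ.real (⋃ i, A i)ᶜ ≤ B * ν.real (⋃ i, A i)ᶜ +
      B * |μ.real (⋃ i, A i)ᶜ - ν.real (⋃ i, A i)ᶜ| := by
    rw [← mul_add]
    refine mul_le_mul_of_nonneg_left ?_ hB
    linarith [le_abs_self (μ.real (⋃ i, A i)ᶜ - ν.real (⋃ i, A i)ᶜ)]
  linarith

variable {𝔛 : Type*} [MetricSpace 𝔛] {ℋ : Type*} [NormedAddCommGroup ℋ] [InnerProductSpace ℝ ℋ]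
  [CompleteSpace ℋ] [RKHS ℝ ℋ 𝔛 ℝ] [MeasurableSpace 𝔛] [BorelSpace 𝔛]

/-- Finitely many cells in `E` control, uniformly in the parameter `ω`, the distance between the
images of two probability measures under `T ω`. -/
theorem exists_cells_wmmd_le (hφ : Continuous fun x : 𝔛 => RKHS.kerFun ℋ x (1 : ℝ))
    {B : ℝ} (hB : ∀ x y : 𝔛, modulus ℋ x y ≤ B) {Θ E : Type*} [TopologicalSpace Θ] [CompactSpace Θ]
    [TopologicalSpace E] [MeasurableSpace E] [BorelSpace E] {T : Θ → E → 𝔛}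
    (hT : Continuous fun q : Θ × E => T q.1 q.2) {C : Set E} (hC : IsCompact C) {ε : ℝ}
    (hε : 0 < ε) :
    ∃ (n : ℕ) (A : Option (Fin n) → Set E), (∀ i, MeasurableSet (A i)) ∧
      ∀ (μ ν : Measure E) [IsProbabilityMeasure μ] [IsProbabilityMeasure ν] (ω : Θ),
        wmmd ℋ (μ.map (T ω)) (ν.map (T ω)) ≤
          2 * (2 * ε + 2 * B * ν.real Cᶜ + B * ∑ i, |μ.real (A i) - ν.real (A i)|) := by
  have hTω : ∀ ω, Continuous (T ω) := fun ω => hT.comp (continuous_const.prodMk continuous_id)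
  -- Tube lemma: compactness of `Θ` gives a neighbourhood of `z` that works for every `ω` at once.
  have hnhds : ∀ z : E, ∃ V : Set E, IsOpen V ∧ z ∈ V ∧
      ∀ e ∈ V, ∀ ω, modulus ℋ (T ω e) (T ω z) ≤ ε := by
    intro z
    have h := isCompact_univ.eventually_forall_of_forall_eventually (X := E) (Y := Θ) (x₀ := z)
      (K := Set.univ) (P := fun e ω => modulus ℋ (T ω e) (T ω z) < ε) (fun ω _ => by
        have hcont : Continuous fun q : E × Θ => modulus ℋ (T q.2 q.1) (T q.2 z) :=
          (continuous_modulus hφ).comp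
            ((hT.comp (continuous_snd.prodMk continuous_fst)).prodMk
              (hT.comp (continuous_snd.prodMk continuous_const)))
        have := hcont.tendsto (z, ω)
        rw [modulus_self] at this
        exact this.eventually (gt_mem_nhds hε))
    obtain ⟨V, hV, hVo, hzV⟩ := eventually_nhds_iff.1 h
    exact ⟨V, hVo, hzV, fun e he ω => (hV e he ω (Set.mem_univ _)).le⟩
  choose V hVo hzV hV using hnhds
  obtain ⟨t, ht⟩ := hC.elim_finite_subcover V hVo fun z _ => Set.mem_iUnion.2 ⟨z, hzV z⟩
  let z : Fin t.card → E := fun i => (t.equivFin.symm i : E)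
  let A : Fin t.card → Set E := disjointed fun i => V (z i)
  have hA : ∀ i, MeasurableSet (A i) := fun i => by
    simp only [A, disjointed_apply, Finset.sup_set_eq_biUnion]
    exact (hVo _).measurableSet.diff
      (Finset.measurableSet_biUnion _ fun j _ => (hVo _).measurableSet)
  have hd : Pairwise (Function.onFun Disjoint A) := disjoint_disjointed _
  have hCA : (⋃ i, A i)ᶜ ⊆ Cᶜ := by
    refine Set.compl_subset_compl.2 (ht.trans ?_)
    have : (⋃ i, A i) = ⋃ i, V (z i) := iUnion_disjointed
    rw [this]
    refine Set.iUnion₂_subset fun x hx => ?_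
    refine Set.subset_iUnion_of_subset (t.equivFin ⟨x, hx⟩) ?_
    simp [z]
  -- The index `none` carries the complement of the cells, whose mass deviation also enters the
  -- bound.
  refine ⟨t.card, fun i => i.elim (⋃ i, A i)ᶜ A, ?_, ?_⟩
  · rintro (_ | i)
    · exact (MeasurableSet.iUnion hA).compl
    · exact hA i
  intro μ ν _ _ ω
  obtain ⟨e₀⟩ : Nonempty E := nonempty_of_isProbabilityMeasure μ
  have hB0 : 0 ≤ B := (modulus_nonneg _ _).trans (hB (T ω e₀) (T ω e₀))
  refine wmmd_le_of_isTest fun g hg => ?_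
  have hgc := hg.continuous hφ
  have hmT : Measurable (T ω) := (hTω ω).measurable
  rw [integral_map hmT.aemeasurable hgc.aestronglyMeasurable,
    integral_map hmT.aemeasurable hgc.aestronglyMeasurable]
  have hi : ∀ ρ : Measure E, IsProbabilityMeasure ρ → Integrable (fun e => g (T ω e)) ρ := by
    intro ρ _
    refine Integrable.of_bound (C := |g (T ω e₀)| + B)
      (hgc.measurable.comp hmT).aestronglyMeasurable (ae_of_all _ fun e => ?_)
    have h1 := (hg (T ω e) (T ω e₀)).trans (hB _ _)
    have h2 := abs_sub_abs_le_abs_sub (g (T ω e)) (g (T ω e₀))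
    rw [Real.norm_eq_abs]
    linarith
  -- Subtracting the value at `e₀` bounds all test functions by the same `B` without changing the
  -- difference of the integrals.
  have key := integral_sub_integral_le_of_cells hA hd
    (f := fun e => g (T ω e) - g (T ω e₀)) ((hgc.measurable.comp hmT).sub_const _)
    (c := fun i => g (T ω (z i)) - g (T ω e₀)) hε.le hB0
    (fun e => (hg _ _).trans (hB _ _)) (fun i => (hg _ _).trans (hB _ _))
    (fun i e he => by
      rw [sub_sub_sub_cancel_right]
      exact (hg _ _).trans (hV (z i) e (disjointed_le (fun i => V (z i)) i he) ω)) μ ν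
  rw [integral_sub (hi μ ‹_›) (integrable_const _), integral_sub (hi ν ‹_›) (integrable_const _)]
    at key
  simp only [integral_const, probReal_univ, one_smul, sub_sub_sub_cancel_right] at key
  rw [Fintype.sum_option]
  have hνC : 2 * B * ν.real (⋃ i, A i)ᶜ ≤ 2 * B * ν.real Cᶜ :=
    mul_le_mul_of_nonneg_left (measureReal_mono hCA) (by positivity)
  exact key.trans (by simp only [Option.elim]; linarith)

end Cells

/-! ### Second moments of independent sums -/

section SecondMoments

theorem lintegral_sq_sum_sub_pi {ι : Type*} [Fintype ι] {Ω : ι → Type*}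
    [∀ i, MeasurableSpace (Ω i)] (μ : (i : ι) → Measure (Ω i)) [∀ i, IsProbabilityMeasure (μ i)]
    {f : (i : ι) → Ω i → ℝ} (hf : ∀ i, MemLp (f i) 2 (μ i)) :
    ∫⁻ y, ENNReal.ofReal ((∑ i, f i (y i) - ∑ i, ∫ x, f i x ∂μ i) ^ 2) ∂Measure.pi μ =
      ENNReal.ofReal (∑ i, Var[f i; μ i]) := by
  have hfi : ∀ i, MemLp (fun y : ∀ i, Ω i => f i (y i)) 2 (Measure.pi μ) := fun i =>
    (hf i).comp_measurePreserving (measurePreserving_eval μ i)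
  have hm : ∫ y, ∑ i, f i (y i) ∂Measure.pi μ = ∑ i, ∫ x, f i x ∂μ i := by
    rw [integral_finsetSum _ fun i _ => (hfi i).integrable (by norm_num)]
    exact Finset.sum_congr rfl fun i _ => integral_comp_eval (hf i).aestronglyMeasurable
  have hsum : (∑ i, fun y : ∀ i, Ω i => f i (y i)) = fun y => ∑ i, f i (y i) := by
    ext y
    simp
  rw [← variance_sum_pi hf, hsum,
    MemLp.ofReal_variance_eq (memLp_finsetSum _ fun i _ => hfi i), evariance, hm]
  refine lintegral_congr fun y => ?_
  rw [← sq_abs, ENNReal.ofReal_pow (abs_nonneg _), Real.enorm_eq_ofReal_abs]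

/-- The second moment of the deviation of a weighted empirical frequency. -/
theorem lintegral_sq_sum_indicator_sub_le {X : Type*} [MeasurableSpace X] (μ : Measure X)
    [IsProbabilityMeasure μ] {A : Set X} (hA : MeasurableSet A) {N : ℕ} (w : Fin N → ℝ) :
    ∫⁻ y, ENNReal.ofReal ((∑ i, w i * A.indicator 1 (y i) - (∑ i, w i) * μ.real A) ^ 2)
      ∂(Measure.pi fun _ : Fin N => μ) ≤ ENNReal.ofReal (∑ i, w i ^ 2) := by
  have hmem : MemLp (A.indicator (1 : X → ℝ)) 2 μ :=
    memLp_indicator_const 2 hA (1 : ℝ) (Or.inr (measure_ne_top _ _))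
  have h := lintegral_sq_sum_sub_pi (fun _ : Fin N => μ)
    (f := fun i x => w i * A.indicator (1 : X → ℝ) x) (fun i => hmem.const_mul (w i))
  simp only [integral_const_mul, integral_indicator_one hA, ← Finset.sum_mul] at h
  rw [h]
  refine ENNReal.ofReal_le_ofReal (Finset.sum_le_sum fun i _ => ?_)
  rw [variance_const_mul]
  refine mul_le_of_le_one_right (sq_nonneg _) ?_
  -- Bhatia–Davis inequality: the variance of the indicator is at most `(1 - p) p` with `p = μ.real
  -- A`.
  have hb := variance_le_sub_mul_sub (μ := μ) (a := 0) (b := 1) (X := A.indicator (1 : X → ℝ))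
    (ae_of_all _ fun x => by by_cases hx : x ∈ A <;> simp [hx])
    hmem.aestronglyMeasurable.aemeasurable
  rw [integral_indicator_one hA] at hb
  have h0 : 0 ≤ μ.real A := measureReal_nonneg
  have h1 : μ.real A ≤ 1 := measureReal_le_one
  nlinarith

end SecondMoments

/-! ### Gamma moments and the expected sum of squared Dirichlet weights -/

section Dirichlet

theorem measurable_gammaPDF (α : ℝ) : Measurable (gammaPDF α 1) :=
  (measurable_gammaPDFReal α 1).ennreal_ofReal

theorem ae_gammaMeasure_pos {α : ℝ} : ∀ᵐ x ∂gammaMeasure α 1, 0 < x := by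
  rw [gammaMeasure, ae_withDensity_iff (measurable_gammaPDF α)]
  have h0 : ∀ᵐ x : ℝ, x ≠ 0 := by simp [ae_iff]
  filter_upwards [h0] with x hx h
  by_contra hneg
  exact h (gammaPDF_of_neg (lt_of_le_of_ne (not_lt.1 hneg) hx))

/-- Multiplying the Gamma(`α`) density by `x ^ β` gives a multiple of the Gamma(`α + β`) density. -/
theorem lintegral_rpow_gammaMeasure {α β : ℝ} (hα : 0 < α) (hβ : 0 ≤ β) :
    ∫⁻ x, ENNReal.ofReal (x ^ β) ∂gammaMeasure α 1 =
      ENNReal.ofReal (Real.Gamma (α + β) / Real.Gamma α) := by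
  have hαβ : 0 < α + β := by linarith
  have hΓ := Real.Gamma_pos_of_pos hα
  have hΓ' := Real.Gamma_pos_of_pos hαβ
  have h : ∀ᵐ x : ℝ, gammaPDF α 1 x * ENNReal.ofReal (x ^ β) =
      ENNReal.ofReal (Real.Gamma (α + β) / Real.Gamma α) * gammaPDF (α + β) 1 x := by
    have h0 : ∀ᵐ x : ℝ, x ≠ 0 := by simp [ae_iff]
    filter_upwards [h0] with x hx
    rcases lt_or_gt_of_ne hx with hx | hx
    · simp [gammaPDF_of_neg hx]
    · rw [gammaPDF_of_nonneg hx.le, gammaPDF_of_nonneg hx.le, ← ENNReal.ofReal_mul (by positivity),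
        ← ENNReal.ofReal_mul (by positivity)]
      congr 1
      rw [show α + β - 1 = (α - 1) + β by ring, Real.rpow_add hx]
      simp only [Real.one_rpow]
      field_simp
  rw [gammaMeasure, lintegral_withDensity_eq_lintegral_mul _
    (measurable_gammaPDF α) (by fun_prop)]
  simp only [Pi.mul_apply]
  rw [lintegral_congr_ae h, lintegral_const_mul _ (measurable_gammaPDF _),
    lintegral_gammaPDF_eq_one hαβ one_pos, mul_one]

theorem lintegral_sq_gammaMeasure {α : ℝ} (hα : 0 < α) :
    ∫⁻ x, ENNReal.ofReal (x ^ 2) ∂gammaMeasure α 1 = ENNReal.ofReal (α * (α + 1)) := by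
  have h := lintegral_rpow_gammaMeasure hα (β := 2) (by norm_num)
  simp only [Real.rpow_two] at h
  have hΓ := Real.Gamma_pos_of_pos hα
  rw [h, show α + 2 = (α + 1) + 1 by ring, Real.Gamma_add_one (by positivity),
    Real.Gamma_add_one hα.ne']
  congr 1
  field_simp

theorem integral_id_gammaMeasure {α : ℝ} (hα : 0 < α) : ∫ x, x ∂gammaMeasure α 1 = α := by
  have h := lintegral_rpow_gammaMeasure hα (β := 1) (by norm_num)
  simp only [Real.rpow_one] at h
  have hΓ := Real.Gamma_pos_of_pos hα
  rw [integral_eq_lintegral_of_nonneg_ae (ae_gammaMeasure_pos.mono fun x hx => hx.le)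
    measurable_id.aestronglyMeasurable, h, Real.Gamma_add_one hα.ne',
    ENNReal.toReal_ofReal (by positivity)]
  field_simp

theorem memLp_id_gammaMeasure {α : ℝ} (hα : 0 < α) :
    MemLp (fun x : ℝ => x) 2 (gammaMeasure α 1) := by
  refine (memLp_two_iff_integrable_sq (f := fun x => x)
    measurable_id.aestronglyMeasurable).2 ?_
  refine ⟨(measurable_id.pow_const 2).aestronglyMeasurable, ?_⟩
  rw [hasFiniteIntegral_iff_ofReal (ae_of_all _ fun x => sq_nonneg x),
    lintegral_sq_gammaMeasure hα]
  exact ENNReal.ofReal_lt_top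

theorem variance_id_gammaMeasure {α : ℝ} (hα : 0 < α) :
    Var[fun x : ℝ => x; gammaMeasure α 1] = α := by
  have := isProbabilityMeasure_gammaMeasure hα one_pos
  rw [variance_eq_sub (memLp_id_gammaMeasure hα), integral_id_gammaMeasure hα]
  simp only [Pi.pow_apply]
  rw [integral_eq_lintegral_of_nonneg_ae (ae_of_all _ fun x => sq_nonneg x)
    (measurable_id.pow_const 2).aestronglyMeasurable, lintegral_sq_gammaMeasure hα,
    ENNReal.toReal_ofReal (by positivity)]
  ring

theorem measurable_normalize {ι : Type*} [Fintype ι] :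
    Measurable fun (g : ι → ℝ) (i : ι) => g i / ∑ j, g j := by
  fun_prop

theorem isProbabilityMeasure_dirichlet {ι : Type*} [Fintype ι] {α : ι → ℝ} (hα : ∀ i, 0 < α i) :
    IsProbabilityMeasure (dirichlet α) := by
  have := fun i => isProbabilityMeasure_gammaMeasure (hα i) one_pos
  exact Measure.isProbabilityMeasure_map measurable_normalize.aemeasurable

theorem ae_pi_gammaMeasure_pos {ι : Type*} [Fintype ι] {α : ι → ℝ} (hα : ∀ i, 0 < α i) :
    ∀ᵐ g ∂(Measure.pi fun i => gammaMeasure (α i) 1), ∀ i, 0 < g i := by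
  have := fun i => isProbabilityMeasure_gammaMeasure (hα i) one_pos
  exact ae_all_iff.2 fun i =>
    (measurePreserving_eval (fun i => gammaMeasure (α i) 1) i).quasiMeasurePreserving.ae
      ae_gammaMeasure_pos

theorem ae_dirichlet_mem_stdSimplex {ι : Type*} [Fintype ι] [Nonempty ι] {α : ι → ℝ}
    (hα : ∀ i, 0 < α i) : ∀ᵐ J ∂dirichlet α, J ∈ stdSimplex ℝ ι := by
  have hm : MeasurableSet {J : ι → ℝ | J ∈ stdSimplex ℝ ι} :=
    (isClosed_stdSimplex ℝ ι).measurableSet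
  rw [dirichlet, ae_map_iff measurable_normalize.aemeasurable hm]
  filter_upwards [ae_pi_gammaMeasure_pos hα] with g hg
  have hs : 0 < ∑ j, g j := Finset.sum_pos (fun j _ => hg j) Finset.univ_nonempty
  refine ⟨fun i => div_nonneg (hg i).le hs.le, ?_⟩
  rw [← Finset.sum_div, div_self hs.ne']

/-- Replaces the random denominator by a constant `c`, later its mean. If the sum `s` is at least `c
/ 2`, then `1 / s² ≤ 4 / c²`; otherwise the left side is at most `1 ≤ 4 (s - c)² / c²`. -/
theorem sum_div_sum_sq_le {ι : Type*} [Fintype ι] [Nonempty ι] {g : ι → ℝ} (hg : ∀ i, 0 < g i)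
    {c : ℝ} (hc : 0 < c) :
    ∑ i, (g i / ∑ j, g j) ^ 2 ≤ 4 / c ^ 2 * (∑ i, g i ^ 2 + (∑ i, g i - c) ^ 2) := by
  have hs : 0 < ∑ j, g j := Finset.sum_pos (fun j _ => hg j) Finset.univ_nonempty
  set s := ∑ j, g j with hs_def
  have hQ : 0 ≤ ∑ i, g i ^ 2 := Finset.sum_nonneg fun i _ => sq_nonneg _
  have hQs : ∑ i, g i ^ 2 ≤ s ^ 2 := Finset.sum_sq_le_sq_sum_of_nonneg fun i _ => (hg i).le
  have e : ∑ i, (g i / s) ^ 2 = (∑ i, g i ^ 2) / s ^ 2 := by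
    simp only [div_pow, Finset.sum_div]
  rw [e, div_le_iff₀ (by positivity), div_mul_eq_mul_div, div_mul_eq_mul_div,
    le_div_iff₀ (by positivity)]
  rcases le_or_gt (c / 2) s with h | h
  · have h1 : c ^ 2 ≤ 4 * s ^ 2 := by nlinarith
    nlinarith [mul_le_mul_of_nonneg_left h1 hQ, sq_nonneg (s - c), mul_nonneg (sq_nonneg (s - c))
      (sq_nonneg s)]
  · have h1 : c ^ 2 ≤ 4 * (s - c) ^ 2 := by nlinarith
    nlinarith [mul_le_mul hQs h1 (sq_nonneg c) (sq_nonneg s), mul_nonneg hQ (sq_nonneg s)]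

/-- The Gamma sum has mean and variance `Nα`, and the squares sum to `Nα(α+1)` in mean, so the bound
is `4/(Nα)² · Nα(α+2)`. -/
theorem lintegral_sum_sq_dirichlet_le {N : ℕ} (hN : 0 < N) {α : ℝ} (hα : 0 < α) :
    ∫⁻ J, ENNReal.ofReal (∑ i, J i ^ 2) ∂dirichlet (fun _ : Fin N => α) ≤
      ENNReal.ofReal (4 / N + 8 / (N * α)) := by
  have := isProbabilityMeasure_gammaMeasure hα one_pos
  have : Nonempty (Fin N) := ⟨⟨0, hN⟩⟩
  have hN' : (0 : ℝ) < N := by exact_mod_cast hN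
  have hc : 0 < N * α := by positivity
  have hm : Measurable fun J : Fin N → ℝ => ENNReal.ofReal (∑ i, J i ^ 2) := by fun_prop
  rw [dirichlet, lintegral_map hm measurable_normalize]
  set π := Measure.pi fun _ : Fin N => gammaMeasure α 1
  have hvar : ∫⁻ g, ENNReal.ofReal ((∑ i, g i - N * α) ^ 2) ∂π = ENNReal.ofReal (N * α) := by
    have h := lintegral_sq_sum_sub_pi (fun _ : Fin N => gammaMeasure α 1) (f := fun _ x => x)
      (fun _ => memLp_id_gammaMeasure hα)
    simpa [integral_id_gammaMeasure hα, variance_id_gammaMeasure hα] using h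
  have hsq : ∫⁻ g, ENNReal.ofReal (∑ i, g i ^ 2) ∂π = ENNReal.ofReal (N * (α * (α + 1))) := by
    have e : ∀ g : Fin N → ℝ, ENNReal.ofReal (∑ i, g i ^ 2) = ∑ i, ENNReal.ofReal (g i ^ 2) :=
      fun g => ENNReal.ofReal_sum_of_nonneg fun i _ => sq_nonneg _
    simp only [e]
    rw [lintegral_finsetSum _ fun i _ => by fun_prop]
    have h1 : ∀ i : Fin N, ∫⁻ g, ENNReal.ofReal (g i ^ 2) ∂π = ENNReal.ofReal (α * (α + 1)) := by
      intro i
      rw [← lintegral_sq_gammaMeasure hα]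
      exact (measurePreserving_eval (fun _ : Fin N => gammaMeasure α 1) i).lintegral_comp
        (f := fun x : ℝ => ENNReal.ofReal (x ^ 2)) (by fun_prop)
    simp only [h1, Finset.sum_const, Finset.card_univ, Fintype.card_fin, nsmul_eq_mul]
    rw [ENNReal.ofReal_mul hN'.le, ENNReal.ofReal_natCast]
  calc ∫⁻ g, ENNReal.ofReal (∑ i, (g i / ∑ j, g j) ^ 2) ∂π
      ≤ ∫⁻ g, ENNReal.ofReal (4 / (N * α) ^ 2) *
          (ENNReal.ofReal (∑ i, g i ^ 2) + ENNReal.ofReal ((∑ i, g i - N * α) ^ 2)) ∂π := by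
        refine lintegral_mono_ae ?_
        filter_upwards [ae_pi_gammaMeasure_pos (α := fun _ : Fin N => α) fun _ => hα] with g hg
        rw [← ENNReal.ofReal_add (Finset.sum_nonneg fun i _ => sq_nonneg _) (sq_nonneg _),
          ← ENNReal.ofReal_mul (by positivity)]
        exact ENNReal.ofReal_le_ofReal (sum_div_sum_sq_le hg hc)
    _ = ENNReal.ofReal (4 / N + 8 / (N * α)) := by
        rw [lintegral_const_mul _ (by fun_prop), lintegral_add_left (by fun_prop), hsq, hvar,
          ← ENNReal.ofReal_add (by positivity) (by positivity),
          ← ENNReal.ofReal_mul (by positivity)]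
        congr 1
        field_simp
        ring

end Dirichlet

/-! ### Squared cell deviations for a tight reference measure -/

section Tight

variable {𝔛 : Type*} [MetricSpace 𝔛] [CompactSpace 𝔛] {ℋ : Type*} [NormedAddCommGroup ℋ]
  [InnerProductSpace ℝ ℋ] [CompleteSpace ℋ] [RKHS ℝ ℋ 𝔛 ℝ] [MeasurableSpace 𝔛] [BorelSpace 𝔛]

/-- The masses of finitely many cells in `E` control, uniformly in the parameter `ω`, the distance
of the image of a probability measure to the image of a fixed tight one. -/
theorem exists_cells_wmmd_le_sum_sq (hφ : Continuous fun x : 𝔛 => RKHS.kerFun ℋ x (1 : ℝ))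
    {Θ E : Type*} [TopologicalSpace Θ] [CompactSpace Θ]
    [TopologicalSpace E] [MeasurableSpace E] [BorelSpace E] {T : Θ → E → 𝔛}
    (hT : Continuous fun q : Θ × E => T q.1 q.2) (ν : Measure E) [IsProbabilityMeasure ν]
    (hν : IsTightMeasureSet {ν}) {ε : ℝ} (hε : 0 < ε) :
    ∃ (n : ℕ) (A : Fin n → Set E) (c : ℝ), 0 ≤ c ∧ (∀ i, MeasurableSet (A i)) ∧
      ∀ (μ : Measure E) [IsProbabilityMeasure μ] (ω : Θ),
        wmmd ℋ (μ.map (T ω)) (ν.map (T ω)) ≤ ε + c * ∑ i, (μ.real (A i) - ν.real (A i)) ^ 2 := by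
  obtain ⟨B, hB0, hB⟩ := exists_modulus_le hφ
  -- The oscillation, tail and mass terms will each cost `ε / 8`, hence `3ε / 4` after doubling.
  -- Using `B + 1` covers `B = 0`.
  have hδ : 0 < ε / (16 * (B + 1)) := by positivity
  obtain ⟨C, hC, hνC⟩ := isTightMeasureSet_iff_exists_isCompact_measure_compl_le.1 hν
    (ENNReal.ofReal (ε / (16 * (B + 1)))) (by simpa using hδ)
  have hνC' : ν.real Cᶜ ≤ ε / (16 * (B + 1)) :=
    ENNReal.toReal_le_of_le_ofReal hδ.le (hνC ν rfl)
  obtain ⟨n, A, hA, h⟩ := exists_cells_wmmd_le hφ hB hT hC (ε := ε / 16) (by positivity)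
  let e : Fin (n + 1) ≃ Option (Fin n) := finSuccEquiv n
  set δ : ℝ := ε / (8 * (n + 1)) with hδ_def
  have hδ0 : 0 < δ := by positivity
  refine ⟨n + 1, fun i => A (e i), 2 * (B ^ 2 / δ), by positivity, fun i => hA _,
    fun μ _ ω => (h μ ν ω).trans ?_⟩
  have h1 : 2 * B * ν.real Cᶜ ≤ ε / 8 := by
    calc 2 * B * ν.real Cᶜ ≤ 2 * (B + 1) * (ε / (16 * (B + 1))) := by gcongr; linarith
      _ = ε / 8 := by field_simp; norm_num
  have h2 : B * ∑ i, |μ.real (A i) - ν.real (A i)| ≤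
      ε / 8 + B ^ 2 / δ * ∑ i, (μ.real (A i) - ν.real (A i)) ^ 2 := by
    -- Young's inequality turns absolute deviations into squares; `δ` is such that its `n + 1`
    -- copies add up to `ε / 8`.
    have h3 : ∀ x : ℝ, B * |x| ≤ δ + B ^ 2 / δ * x ^ 2 := by
      intro x
      rw [← sq_abs x, div_mul_eq_mul_div, ← sub_le_iff_le_add', le_div_iff₀ hδ0]
      nlinarith [sq_nonneg (δ - B * |x|), abs_nonneg x,
        mul_nonneg hδ0.le (mul_nonneg hB0 (abs_nonneg x))]
    calc B * ∑ i, |μ.real (A i) - ν.real (A i)|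
        = ∑ i, B * |μ.real (A i) - ν.real (A i)| := Finset.mul_sum _ _ _
      _ ≤ ∑ i, (δ + B ^ 2 / δ * (μ.real (A i) - ν.real (A i)) ^ 2) :=
          Finset.sum_le_sum fun i _ => h3 _
      _ = _ := by
          rw [Finset.sum_add_distrib, ← Finset.mul_sum]
          simp only [Finset.sum_const, Finset.card_univ, Fintype.card_option, Fintype.card_fin,
            nsmul_eq_mul, hδ_def]
          push_cast
          congr 1
          field_simp
  rw [Equiv.sum_comp e fun i => (μ.real (A i) - ν.real (A i)) ^ 2]
  linarith

end Tight

/-! ### Mean square deviations of cell masses under the sampling law -/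

section Sampling

variable {𝔛 : Type*} [MeasurableSpace 𝔛]

theorem real_discreteMeasure {N : ℕ} {J : Fin N → ℝ} (hJ : ∀ i, 0 ≤ J i) (x : Fin N → 𝔛)
    {A : Set 𝔛} (hA : MeasurableSet A) :
    (discreteMeasure J x).real A = ∑ i, J i * A.indicator 1 (x i) := by
  rw [discreteMeasure, measureReal_def, Measure.finsetSum_apply,
    ENNReal.toReal_sum fun i _ => by
      simpa using ENNReal.mul_ne_top ENNReal.ofReal_ne_top (measure_ne_top _ _)]
  refine Finset.sum_congr rfl fun i _ => ?_
  rw [Measure.smul_apply, smul_eq_mul, ENNReal.toReal_mul, ENNReal.toReal_ofReal (hJ i),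
    Measure.dirac_apply' _ hA]
  by_cases h : x i ∈ A <;> simp [h]

theorem isProbabilityMeasure_discreteMeasure {N : ℕ} {J : Fin N → ℝ}
    (hJ : J ∈ stdSimplex ℝ (Fin N)) (x : Fin N → 𝔛) :
    IsProbabilityMeasure (discreteMeasure J x) := by
  refine ⟨?_⟩
  have h := real_discreteMeasure hJ.1 x MeasurableSet.univ
  simp only [Set.indicator_univ, Pi.one_apply, mul_one, hJ.2] at h
  rw [measureReal_def] at h
  rw [← ENNReal.ofReal_toReal (measure_ne_top (discreteMeasure J x) Set.univ), h,
    ENNReal.ofReal_one]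

theorem const_mem_stdSimplex {n : ℕ} (hn : 0 < n) :
    (fun _ => 1 / (n : ℝ)) ∈ stdSimplex ℝ (Fin n) := by
  refine ⟨fun _ => by positivity, ?_⟩
  have : (n : ℝ) ≠ 0 := by positivity
  simp [this]

theorem isProbabilityMeasure_empirical {n : ℕ} (hn : 0 < n) (x : Fin n → 𝔛) :
    IsProbabilityMeasure (empirical x) :=
  isProbabilityMeasure_discreteMeasure (const_mem_stdSimplex hn) x

theorem map_empirical {𝔜 : Type*} [MeasurableSpace 𝔜] {n : ℕ} (x : Fin n → 𝔛) {f : 𝔛 → 𝔜}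
    (hf : Measurable f) : (empirical x).map f = empirical fun i => f (x i) := by
  ext s hs
  rw [Measure.map_apply hf hs]
  simp only [empirical, discreteMeasure, Measure.finsetSum_apply, Measure.smul_apply]
  refine Finset.sum_congr rfl fun i _ => ?_
  rw [Measure.dirac_apply' _ hs, Measure.dirac_apply' _ (hf hs)]
  rfl

theorem real_posteriorBase {a : ℝ} (ha : 0 < a) (H : Measure 𝔛) [IsFiniteMeasure H] {n : ℕ}
    (x : Fin n → 𝔛) (A : Set 𝔛) : (posteriorBase a H x).real A =
      a / (a + n) * H.real A + n / (a + n) * (empirical x).real A := by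
  have h1 : H A ≠ ∞ := measure_ne_top _ _
  have h2 : (empirical x) A ≠ ∞ := measure_ne_top (discreteMeasure _ x) _
  rw [posteriorBase, measureReal_def, Measure.add_apply, Measure.smul_apply, Measure.smul_apply,
    smul_eq_mul, smul_eq_mul, ENNReal.toReal_add (ENNReal.mul_ne_top ENNReal.ofReal_ne_top h1)
      (ENNReal.mul_ne_top ENNReal.ofReal_ne_top h2), ENNReal.toReal_mul, ENNReal.toReal_mul,
    ENNReal.toReal_ofReal (by positivity), ENNReal.toReal_ofReal (by positivity)]
  rfl

theorem isProbabilityMeasure_posteriorBase {a : ℝ} (ha : 0 < a) (H : Measure 𝔛)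
    [IsProbabilityMeasure H] {n : ℕ} (hn : 0 < n) (x : Fin n → 𝔛) :
    IsProbabilityMeasure (posteriorBase a H x) := by
  have := isProbabilityMeasure_empirical hn x
  refine ⟨?_⟩
  have h := real_posteriorBase ha H x Set.univ
  have hne : a + n ≠ 0 := by positivity
  rw [probReal_univ (μ := H), probReal_univ (μ := empirical x), mul_one, mul_one,
    ← add_div, div_self hne, measureReal_def] at h
  rw [← ENNReal.ofReal_toReal (measure_ne_top (posteriorBase a H x) Set.univ), h,
    ENNReal.ofReal_one]

theorem isMarkovKernel_posteriorDraws {a : ℝ} (ha : 0 < a) (H : Measure 𝔛)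
    [IsProbabilityMeasure H] {n : ℕ} (hn : 0 < n) (N : ℕ) :
    IsMarkovKernel (posteriorDraws a H n N) := by
  refine ⟨fun x => ?_⟩
  have := isProbabilityMeasure_posteriorBase ha H hn x
  change IsProbabilityMeasure (Measure.pi fun _ : Fin N => posteriorBase a H x)
  infer_instance

variable {E : Type*} [MeasurableSpace E]

theorem ae_sampleLaw_mem_stdSimplex (F H : Measure 𝔛) [IsProbabilityMeasure F]
    [IsProbabilityMeasure H] {a : ℝ} (ha : 0 < a) (ν : Measure E) [IsProbabilityMeasure ν]
    {n N : ℕ} (hn : 0 < n) (hN : 0 < N) :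
    ∀ᵐ q ∂sampleLaw F H a ν n N, q.2.1 ∈ stdSimplex ℝ (Fin N) := by
  have := isMarkovKernel_posteriorDraws ha H hn N
  have : Nonempty (Fin N) := ⟨⟨0, hN⟩⟩
  have hα : ∀ _ : Fin N, 0 < (a + n) / N := fun _ => by positivity
  have := isProbabilityMeasure_dirichlet hα
  have h := (Measure.quasiMeasurePreserving_fst (ν := Measure.pi fun _ : Fin N => ν)).ae
    (ae_dirichlet_mem_stdSimplex hα)
  exact Measure.quasiMeasurePreserving_snd.ae h

theorem lintegral_sq_noise_sub_le (F H : Measure 𝔛) [IsProbabilityMeasure F]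
    [IsProbabilityMeasure H] {a : ℝ} (ha : 0 < a) (ν : Measure E) [IsProbabilityMeasure ν]
    {n N : ℕ} (hn : 0 < n) (hN : 0 < N) {A : Set E} (hA : MeasurableSet A) :
    ∫⁻ q, ENNReal.ofReal (((∑ i, 1 / (N : ℝ) * A.indicator 1 (q.2.2 i)) - ν.real A) ^ 2)
      ∂sampleLaw F H a ν n N ≤ ENNReal.ofReal (1 / N) := by
  have := isMarkovKernel_posteriorDraws ha H hn N
  have hα : ∀ _ : Fin N, 0 < (a + n) / N := fun _ => by positivity
  have := isProbabilityMeasure_dirichlet hα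
  have hN' : (N : ℝ) ≠ 0 := by positivity
  have hm : Measurable fun z : Fin N → E =>
      ENNReal.ofReal (((∑ i, 1 / (N : ℝ) * A.indicator 1 (z i)) - ν.real A) ^ 2) := by
    have : Measurable (A.indicator (1 : E → ℝ)) := measurable_one.indicator hA
    fun_prop
  have hp : MeasurePreserving (fun q : ((Fin n → 𝔛) × (Fin N → 𝔛)) × ((Fin N → ℝ) × (Fin N → E))
      => q.2.2) (sampleLaw F H a ν n N) (Measure.pi fun _ : Fin N => ν) :=
    measurePreserving_snd.comp measurePreserving_snd
  rw [hp.lintegral_comp hm]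
  have h := lintegral_sq_sum_indicator_sub_le ν hA fun _ : Fin N => 1 / (N : ℝ)
  rw [(const_mem_stdSimplex hN).2] at h
  simp only [one_mul] at h
  refine h.trans (ENNReal.ofReal_le_ofReal (le_of_eq ?_))
  simp only [Finset.sum_const, Finset.card_univ, Fintype.card_fin, nsmul_eq_mul]
  field_simp

theorem lintegral_sq_empirical_sub_le (F : Measure 𝔛) [IsProbabilityMeasure F] {n : ℕ}
    (hn : 0 < n) {A : Set 𝔛} (hA : MeasurableSet A) :
    ∫⁻ x, ENNReal.ofReal (((empirical x).real A - F.real A) ^ 2) ∂(Measure.pi fun _ : Fin n => F) ≤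
      ENNReal.ofReal (1 / n) := by
  have hn' : (n : ℝ) ≠ 0 := by positivity
  have h := lintegral_sq_sum_indicator_sub_le F hA fun _ : Fin n => 1 / (n : ℝ)
  rw [(const_mem_stdSimplex hn).2] at h
  simp only [one_mul] at h
  simp only [empirical, real_discreteMeasure (const_mem_stdSimplex hn).1 _ hA]
  refine h.trans (ENNReal.ofReal_le_ofReal (le_of_eq ?_))
  simp only [Finset.sum_const, Finset.card_univ, Fintype.card_fin, nsmul_eq_mul]
  field_simp

theorem measurable_real_posteriorBase (a : ℝ) (H : Measure 𝔛) (n : ℕ) {A : Set 𝔛}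
    (hA : MeasurableSet A) : Measurable fun x : Fin n → 𝔛 => (posteriorBase a H x).real A :=
  (measurable_posteriorBase_apply a H n hA).ennreal_toReal

theorem lintegral_sq_posteriorBase_sub_le (F H : Measure 𝔛) [IsProbabilityMeasure F]
    [IsProbabilityMeasure H] {a : ℝ} (ha : 0 < a) {n : ℕ} (hn : 0 < n) {A : Set 𝔛}
    (hA : MeasurableSet A) :
    ∫⁻ x, ENNReal.ofReal (((posteriorBase a H x).real A - F.real A) ^ 2)
      ∂(Measure.pi fun _ : Fin n => F) ≤ ENNReal.ofReal (2 * (a + 1) / n) := by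
  have hn' : (0 : ℝ) < n := by positivity
  have hle : ∀ x : Fin n → 𝔛, ((posteriorBase a H x).real A - F.real A) ^ 2 ≤
      2 * a / n + 2 * ((empirical x).real A - F.real A) ^ 2 := by
    intro x
    rw [real_posteriorBase ha]
    set s := (empirical x).real A - F.real A
    set d := H.real A - F.real A
    have hs : 0 < a + n := by positivity
    -- The deviation is a convex combination of a bounded prior error `d`, with weight `a / (a +
    -- n)`, and the empirical error `s`.
    have e : a / (a + n) * H.real A + n / (a + n) * (empirical x).real A - F.real A =
        a / (a + n) * d + n / (a + n) * s := by
      simp only [s, d]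
      field_simp
      ring
    have hd : d ^ 2 ≤ 1 := by
      have := measureReal_le_one (μ := H) (s := A)
      have := measureReal_le_one (μ := F) (s := A)
      have := measureReal_nonneg (μ := H) (s := A)
      have := measureReal_nonneg (μ := F) (s := A)
      rw [sq_le_one_iff_abs_le_one, abs_le]
      constructor <;> linarith
    have h1 : (a / (a + n)) ^ 2 ≤ a / n := by
      have h1 : a / (a + n) ≤ 1 := by rw [div_le_one hs]; linarith
      have h2 : a / (a + n) ≤ a / n := by gcongr; linarith
      have h3 : 0 ≤ a / (a + n) := by positivity
      nlinarith
    have h2 : (n / (a + n)) ^ 2 ≤ 1 := by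
      have h1 : n / (a + n) ≤ 1 := by rw [div_le_one hs]; linarith
      have h3 : 0 ≤ n / (a + n) := by positivity
      nlinarith
    rw [e]
    calc (a / (a + n) * d + n / (a + n) * s) ^ 2
        ≤ 2 * ((a / (a + n)) ^ 2 * d ^ 2) + 2 * ((n / (a + n)) ^ 2 * s ^ 2) := by
          nlinarith [sq_nonneg (a / (a + n) * d - n / (a + n) * s)]
      _ ≤ 2 * (a / n * 1) + 2 * (1 * s ^ 2) := by gcongr
      _ = _ := by ring
  calc _ ≤ ∫⁻ x, (ENNReal.ofReal (2 * a / n) + ENNReal.ofReal 2 *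
        ENNReal.ofReal (((empirical x).real A - F.real A) ^ 2)) ∂(Measure.pi fun _ : Fin n => F) := by
        refine lintegral_mono fun x => ?_
        rw [← ENNReal.ofReal_mul zero_le_two, ← ENNReal.ofReal_add (by positivity) (by positivity)]
        exact ENNReal.ofReal_le_ofReal (hle x)
    _ ≤ ENNReal.ofReal (2 * a / n) + ENNReal.ofReal 2 * ENNReal.ofReal (1 / n) := by
        rw [lintegral_add_left measurable_const, lintegral_const_mul' _ _ ENNReal.ofReal_ne_top,
          lintegral_const, measure_univ, mul_one]
        gcongr
        exact lintegral_sq_empirical_sub_le F hn hA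
    _ = ENNReal.ofReal (2 * (a + 1) / n) := by
        rw [← ENNReal.ofReal_mul zero_le_two, ← ENNReal.ofReal_add (by positivity) (by positivity)]
        congr 1
        field_simp

/-- With data and weights fixed, the atoms are i.i.d. from `H*` and the inner mean square is at most
`∑ J_i²`. The weights are integrated last, so that bound has to hold for arbitrary vectors; hence
the factor `∑ J_i` beside the `H*`-mass. -/
theorem lintegral_sq_atoms_sub_le (F H : Measure 𝔛) [IsProbabilityMeasure F]
    [IsProbabilityMeasure H] {a : ℝ} (ha : 0 < a) (ν : Measure E) [IsProbabilityMeasure ν]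
    {n N : ℕ} (hn : 0 < n) (hN : 0 < N) {A : Set 𝔛} (hA : MeasurableSet A) :
    ∫⁻ q, ENNReal.ofReal (((∑ i, q.2.1 i * A.indicator 1 (q.1.2 i)) -
        (∑ i, q.2.1 i) * (posteriorBase a H q.1.1).real A) ^ 2)
      ∂sampleLaw F H a ν n N ≤ ENNReal.ofReal (4 / N + 8 / (a + n)) := by
  have := isMarkovKernel_posteriorDraws ha H hn N
  have hα : ∀ _ : Fin N, 0 < (a + n) / N := fun _ => by positivity
  have := isProbabilityMeasure_dirichlet hα
  have hN' : (N : ℝ) ≠ 0 := by positivity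
  have hind : Measurable (A.indicator (1 : 𝔛 → ℝ)) := measurable_one.indicator hA
  have hbase := measurable_real_posteriorBase a H n hA
  have hm : Measurable fun q : ((Fin n → 𝔛) × (Fin N → 𝔛)) × ((Fin N → ℝ) × (Fin N → E)) =>
      ENNReal.ofReal (((∑ i, q.2.1 i * A.indicator 1 (q.1.2 i)) -
        (∑ i, q.2.1 i) * (posteriorBase a H q.1.1).real A) ^ 2) := by
    have : Measurable fun q : ((Fin n → 𝔛) × (Fin N → 𝔛)) × ((Fin N → ℝ) × (Fin N → E)) =>
      (posteriorBase a H q.1.1).real A := hbase.comp (measurable_fst.comp measurable_fst)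
    fun_prop
  rw [sampleLaw, lintegral_prod_symm' _ hm]
  have hinner : ∀ d : (Fin N → ℝ) × (Fin N → E),
      ∫⁻ r, ENNReal.ofReal (((∑ i, d.1 i * A.indicator 1 (r.2 i)) -
        (∑ i, d.1 i) * (posteriorBase a H r.1).real A) ^ 2)
        ∂((Measure.pi fun _ : Fin n => F) ⊗ₘ posteriorDraws a H n N) ≤
      ENNReal.ofReal (∑ i, d.1 i ^ 2) := by
    intro d
    have h := Measure.lintegral_compProd (μ := Measure.pi fun _ : Fin n => F)
      (κ := posteriorDraws a H n N) (hm.comp (measurable_prodMk_right (y := d)))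
    simp only [Function.comp_def] at h
    rw [h]
    calc _ ≤ ∫⁻ _ : Fin n → 𝔛, ENNReal.ofReal (∑ i, d.1 i ^ 2)
          ∂(Measure.pi fun _ : Fin n => F) := by
          refine lintegral_mono fun x => ?_
          have := isProbabilityMeasure_posteriorBase ha H hn x
          exact lintegral_sq_sum_indicator_sub_le (posteriorBase a H x) hA d.1
      _ = _ := by simp
  refine (lintegral_mono hinner).trans ?_
  have hm2 : Measurable fun J : Fin N → ℝ => ENNReal.ofReal (∑ i, J i ^ 2) := by fun_prop
  rw [measurePreserving_fst.lintegral_comp hm2]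
  refine (lintegral_sum_sq_dirichlet_le hN (α := (a + n) / N) (by positivity)).trans (le_of_eq ?_)
  rw [mul_div_cancel₀ _ hN']

/-- The masses given to a set by the approximate posterior and by the data distribution are close
in mean square. -/
theorem lintegral_sq_posterior_sub_le (F H : Measure 𝔛) [IsProbabilityMeasure F]
    [IsProbabilityMeasure H] {a : ℝ} (ha : 0 < a) (ν : Measure E) [IsProbabilityMeasure ν]
    {n N : ℕ} (hn : 0 < n) (hN : 0 < N) {A : Set 𝔛} (hA : MeasurableSet A) :
    ∫⁻ q, ENNReal.ofReal (((∑ i, q.2.1 i * A.indicator 1 (q.1.2 i)) - F.real A) ^ 2)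
      ∂sampleLaw F H a ν n N ≤ ENNReal.ofReal (8 / N + (4 * a + 20) / n) := by
  have := isMarkovKernel_posteriorDraws ha H hn N
  have hα : ∀ _ : Fin N, 0 < (a + n) / N := fun _ => by positivity
  have := isProbabilityMeasure_dirichlet hα
  have hn' : (0 : ℝ) < n := by positivity
  have hbase : Measurable fun x : Fin n → 𝔛 =>
      ENNReal.ofReal (((posteriorBase a H x).real A - F.real A) ^ 2) :=
    (((measurable_real_posteriorBase a H n hA).sub_const _).pow_const 2).ennreal_ofReal
  have hp : MeasurePreserving (fun q : ((Fin n → 𝔛) × (Fin N → 𝔛)) × ((Fin N → ℝ) × (Fin N → E))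
      => q.1.1) (sampleLaw F H a ν n N) (Measure.pi fun _ : Fin n => F) := by
    refine MeasurePreserving.comp (g := Prod.fst)
      (μb := (Measure.pi fun _ : Fin n => F) ⊗ₘ posteriorDraws a H n N)
      ⟨measurable_fst, ?_⟩ measurePreserving_fst
    exact Measure.fst_compProd _ _
  have hcomp : Measurable fun q : ((Fin n → 𝔛) × (Fin N → 𝔛)) × ((Fin N → ℝ) × (Fin N → E)) =>
      ENNReal.ofReal (((posteriorBase a H q.1.1).real A - F.real A) ^ 2) :=
    hbase.comp hp.measurable
  calc _ ≤ ∫⁻ q, ENNReal.ofReal 2 * (ENNReal.ofReal (((∑ i, q.2.1 i * A.indicator 1 (q.1.2 i)) -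
          (∑ i, q.2.1 i) * (posteriorBase a H q.1.1).real A) ^ 2) +
          ENNReal.ofReal (((posteriorBase a H q.1.1).real A - F.real A) ^ 2))
        ∂sampleLaw F H a ν n N := by
        refine lintegral_mono_ae ?_
        -- The weights sum to one almost surely, so the deviation splits at `H*(A)` into an atom
        -- error and a base-measure error.
        filter_upwards [ae_sampleLaw_mem_stdSimplex F H ha ν hn hN] with q hq
        rw [hq.2, one_mul, ← ENNReal.ofReal_add (sq_nonneg _) (sq_nonneg _),
          ← ENNReal.ofReal_mul zero_le_two]
        refine ENNReal.ofReal_le_ofReal ?_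
        set u := ∑ i, q.2.1 i * A.indicator (1 : 𝔛 → ℝ) (q.1.2 i)
        set p := (posteriorBase a H q.1.1).real A
        nlinarith [sq_nonneg ((u - p) - (p - F.real A))]
    _ ≤ ENNReal.ofReal 2 * (ENNReal.ofReal (4 / N + 8 / (a + n)) +
          ENNReal.ofReal (2 * (a + 1) / n)) := by
        rw [lintegral_const_mul' _ _ ENNReal.ofReal_ne_top,
          lintegral_add_right _ hcomp, hp.lintegral_comp hbase]
        gcongr
        · exact lintegral_sq_atoms_sub_le F H ha ν hn hN hA
        · exact lintegral_sq_posteriorBase_sub_le F H ha hn hA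
    _ ≤ ENNReal.ofReal (8 / N + (4 * a + 20) / n) := by
        rw [← ENNReal.ofReal_add (by positivity) (by positivity), ← ENNReal.ofReal_mul zero_le_two]
        refine ENNReal.ofReal_le_ofReal ?_
        have h1 : 8 / (a + n) ≤ 8 / (n : ℝ) := by gcongr; linarith
        have h2 : 2 * (4 / (N : ℝ) + 8 / n + 2 * (a + 1) / n) = 8 / N + (4 * a + 20) / n := by ring
        linarith

end Sampling

/-! ### Continuity in the parameter and near-optimality of minimisers -/

section Minimiser

variable {𝔛 : Type*} [MetricSpace 𝔛] [CompactSpace 𝔛] {ℋ : Type*} [NormedAddCommGroup ℋ]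
  [InnerProductSpace ℝ ℋ] [CompleteSpace ℋ] [RKHS ℝ ℋ 𝔛 ℝ] [MeasurableSpace 𝔛] [BorelSpace 𝔛]

/-- By the triangle inequality the change is at most twice the mean modulus between `G ω` and `G
ω₀`, which vanishes by dominated convergence. This yields measurability and boundedness of the
random distance. -/
theorem continuous_wmmd_map (hφ : Continuous fun x : 𝔛 => RKHS.kerFun ℋ x (1 : ℝ))
    (F : Measure 𝔛) [IsProbabilityMeasure F] {Θ E : Type*} [TopologicalSpace Θ]
    [FirstCountableTopology Θ] [TopologicalSpace E] [MeasurableSpace E] [OpensMeasurableSpace E]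
    (ν : Measure E) [IsProbabilityMeasure ν] {G : Θ → E → 𝔛}
    (hG : Continuous fun q : Θ × E => G q.1 q.2) :
    Continuous fun ω => wmmd ℋ F (ν.map (G ω)) := by
  obtain ⟨B, -, hB⟩ := exists_modulus_le hφ
  have hm : ∀ ω, Measurable (G ω) := fun ω =>
    (hG.comp (continuous_const.prodMk continuous_id)).measurable
  have hp : ∀ ω, IsProbabilityMeasure (ν.map (G ω)) := fun ω =>
    Measure.isProbabilityMeasure_map (hm ω).aemeasurable
  refine continuous_iff_continuousAt.2 fun ω₀ => ?_
  have hc : Continuous fun ω => 2 * ∫ z, modulus ℋ (G ω z) (G ω₀ z) ∂ν := by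
    refine continuous_const.mul (continuous_of_dominated (bound := fun _ => B) (fun ω => ?_)
      (fun ω => ae_of_all _ fun z => ?_) (integrable_const _) (ae_of_all _ fun z => ?_))
    · exact ((continuous_modulus hφ).measurable.comp ((hm ω).prodMk (hm ω₀))).aestronglyMeasurable
    · rw [Real.norm_of_nonneg (modulus_nonneg _ _)]
      exact hB _ _
    · exact (continuous_modulus hφ).comp
        ((hG.comp (continuous_id.prodMk continuous_const)).prodMk continuous_const)
  have h0 := hc.tendsto ω₀
  simp only [modulus_self, integral_zero, mul_zero] at h0
  rw [ContinuousAt, tendsto_iff_dist_tendsto_zero]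
  refine squeeze_zero (fun _ => dist_nonneg) (fun ω => ?_) h0
  have h1 := wmmd_triangle hφ F (ν.map (G ω)) (ν.map (G ω₀))
  have h2 := wmmd_triangle hφ F (ν.map (G ω₀)) (ν.map (G ω))
  have h3 := wmmd_map_le hφ ν (hm ω) (hm ω₀)
  rw [wmmd_comm (ν.map (G ω₀))] at h2
  rw [Real.dist_eq, abs_le]
  constructor <;> linarith

/-- A minimiser of the distance to an approximation of `F`, over approximations of a family that
contains `F`, is nearly optimal. -/
theorem wmmd_le_of_minimiser (hφ : Continuous fun x : 𝔛 => RKHS.kerFun ℋ x (1 : ℝ)) {Θ : Type*}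
    (F μ : Measure 𝔛) [IsProbabilityMeasure F] [IsProbabilityMeasure μ] (G G' : Θ → Measure 𝔛)
    [∀ ω, IsProbabilityMeasure (G ω)] [∀ ω, IsProbabilityMeasure (G' ω)] {ω₀ ω₁ : Θ}
    (hω₀ : wmmd ℋ F (G ω₀) = 0) (hω₁ : wmmd ℋ μ (G' ω₁) ≤ wmmd ℋ μ (G' ω₀)) {r : ℝ}
    (hr : ∀ ω, wmmd ℋ (G' ω) (G ω) ≤ r) : wmmd ℋ F (G ω₁) ≤ 2 * wmmd ℋ μ F + 2 * r := by
  -- Path from `F` through `μ` and `G' ω₁` to `G ω₁`; minimality replaces `ω₁` by `ω₀` in the middle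
  -- leg, which then returns through `F` and `G ω₀`.
  have h1 := wmmd_triangle hφ F μ (G ω₁)
  have h2 := wmmd_triangle hφ μ (G' ω₁) (G ω₁)
  have h3 := wmmd_triangle hφ μ F (G' ω₀)
  have h4 := wmmd_triangle hφ F (G ω₀) (G' ω₀)
  have h5 := hr ω₁
  have h6 := hr ω₀
  rw [wmmd_comm F μ] at h1
  rw [wmmd_comm (G ω₀)] at h4
  linarith

end Minimiser

/-! ### From cell bounds to expectations -/

section Expectation

variable {𝔛 : Type*} [MeasurableSpace 𝔛] {E : Type*} [MeasurableSpace E]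

/-- The expectation of a quantity controlled by the squared deviations of the masses of finitely
many cells. -/
theorem integral_le_of_le_sum_sq (F H : Measure 𝔛) [IsProbabilityMeasure F]
    [IsProbabilityMeasure H] {a : ℝ} (ha : 0 < a) (ν : Measure E) [IsProbabilityMeasure ν]
    {n N : ℕ} (hn : 0 < n) (hN : 0 < N) {S : Type*} [MeasurableSpace S] {P : Measure S}
    {Y : S → ((Fin n → 𝔛) × (Fin N → 𝔛)) × ((Fin N → ℝ) × (Fin N → E))}
    (hY : HasLaw Y (sampleLaw F H a ν n N) P) {f : S → ℝ} (hf : Integrable f P)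
    (hf0 : ∀ s, 0 ≤ f s) {m m' : ℕ} {A : Fin m → Set 𝔛} (hA : ∀ i, MeasurableSet (A i))
    {A' : Fin m' → Set E} (hA' : ∀ i, MeasurableSet (A' i)) {ε c c' : ℝ} (hε : 0 ≤ ε) (hc : 0 ≤ c)
    (hc' : 0 ≤ c')
    (hle : ∀ᵐ s ∂P, f s ≤ ε +
      c * ∑ j, ((∑ i, (Y s).2.1 i * (A j).indicator 1 ((Y s).1.2 i)) - F.real (A j)) ^ 2 +
      c' * ∑ j, ((∑ i, 1 / (N : ℝ) * (A' j).indicator 1 ((Y s).2.2 i)) - ν.real (A' j)) ^ 2) :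
    ∫ s, f s ∂P ≤ ε + c * (m * (8 / N + (4 * a + 20) / n)) + c' * (m' * (1 / N)) := by
  have := isMarkovKernel_posteriorDraws ha H hn N
  have hα : ∀ _ : Fin N, 0 < (a + n) / N := fun _ => by positivity
  have := isProbabilityMeasure_dirichlet hα
  have : IsProbabilityMeasure (sampleLaw F H a ν n N) := by
    unfold sampleLaw
    infer_instance
  let u : Fin m → ((Fin n → 𝔛) × (Fin N → 𝔛)) × ((Fin N → ℝ) × (Fin N → E)) → ℝ := fun j q =>
    ((∑ i, q.2.1 i * (A j).indicator 1 (q.1.2 i)) - F.real (A j)) ^ 2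
  let v : Fin m' → ((Fin n → 𝔛) × (Fin N → 𝔛)) × ((Fin N → ℝ) × (Fin N → E)) → ℝ := fun j q =>
    ((∑ i, 1 / (N : ℝ) * (A' j).indicator 1 (q.2.2 i)) - ν.real (A' j)) ^ 2
  have hu : ∀ j, Measurable fun q => ENNReal.ofReal (u j q) := fun j => by
    have : Measurable ((A j).indicator (1 : 𝔛 → ℝ)) := measurable_one.indicator (hA j)
    fun_prop
  have hv : ∀ j, Measurable fun q => ENNReal.ofReal (v j q) := fun j => by
    have : Measurable ((A' j).indicator (1 : E → ℝ)) := measurable_one.indicator (hA' j)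
    fun_prop
  have hsu : Measurable fun q => ∑ j, ENNReal.ofReal (u j q) :=
    Finset.measurable_fun_sum _ fun j _ => hu j
  have hsv : Measurable fun q => ∑ j, ENNReal.ofReal (v j q) :=
    Finset.measurable_fun_sum _ fun j _ => hv j
  -- Lower integrals of nonnegative terms spare integrability of the individual squares.
  have hbound : ∀ᵐ s ∂P, ENNReal.ofReal (f s) ≤ ENNReal.ofReal ε +
      ENNReal.ofReal c * ∑ j, ENNReal.ofReal (u j (Y s)) +
      ENNReal.ofReal c' * ∑ j, ENNReal.ofReal (v j (Y s)) := by
    filter_upwards [hle] with s hs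
    have h1 : ∀ j ∈ Finset.univ, 0 ≤ u j (Y s) := fun j _ => sq_nonneg _
    have h2 : ∀ j ∈ Finset.univ, 0 ≤ v j (Y s) := fun j _ => sq_nonneg _
    have h3 := Finset.sum_nonneg h1
    have h4 := Finset.sum_nonneg h2
    rw [← ENNReal.ofReal_sum_of_nonneg h1, ← ENNReal.ofReal_sum_of_nonneg h2,
      ← ENNReal.ofReal_mul hc, ← ENNReal.ofReal_mul hc', ← ENNReal.ofReal_add (by positivity)
        (by positivity), ← ENNReal.ofReal_add (by positivity) (by positivity)]
    exact ENNReal.ofReal_le_ofReal hs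
  refine (ENNReal.ofReal_le_ofReal_iff (by positivity)).1 ?_
  rw [ofReal_integral_eq_lintegral_ofReal hf (ae_of_all _ hf0)]
  calc ∫⁻ s, ENNReal.ofReal (f s) ∂P ≤ _ := lintegral_mono_ae hbound
    _ = ∫⁻ q, (ENNReal.ofReal ε + ENNReal.ofReal c * ∑ j, ENNReal.ofReal (u j q) +
          ENNReal.ofReal c' * ∑ j, ENNReal.ofReal (v j q)) ∂sampleLaw F H a ν n N :=
        hY.lintegral_comp (f := fun q => ENNReal.ofReal ε +
          ENNReal.ofReal c * ∑ j, ENNReal.ofReal (u j q) +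
          ENNReal.ofReal c' * ∑ j, ENNReal.ofReal (v j q))
          ((measurable_const.add (hsu.const_mul _)).add (hsv.const_mul _)).aemeasurable
    _ = ENNReal.ofReal ε +
        ENNReal.ofReal c * ∑ j, ∫⁻ q, ENNReal.ofReal (u j q) ∂sampleLaw F H a ν n N +
        ENNReal.ofReal c' * ∑ j, ∫⁻ q, ENNReal.ofReal (v j q) ∂sampleLaw F H a ν n N := by
        rw [lintegral_add_right _ (hsv.const_mul _), lintegral_add_right _ (hsu.const_mul _),
          lintegral_const_mul _ hsu, lintegral_const_mul _ hsv, lintegral_const, measure_univ,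
          mul_one, lintegral_finsetSum _ fun j _ => hu j, lintegral_finsetSum _ fun j _ => hv j]
    _ ≤ ENNReal.ofReal ε +
        ENNReal.ofReal c * ∑ _j : Fin m, ENNReal.ofReal (8 / N + (4 * a + 20) / n) +
        ENNReal.ofReal c' * ∑ _j : Fin m', ENNReal.ofReal (1 / N) := by
        gcongr with j _ j _
        · exact lintegral_sq_posterior_sub_le F H ha ν hn hN (hA j)
        · exact lintegral_sq_noise_sub_le F H ha ν hn hN (hA' j)
    _ = _ := by
        simp only [Finset.sum_const, Finset.card_univ, Fintype.card_fin, nsmul_eq_mul]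
        rw [← ENNReal.ofReal_natCast m, ← ENNReal.ofReal_natCast m',
          ← ENNReal.ofReal_mul (Nat.cast_nonneg _), ← ENNReal.ofReal_mul (Nat.cast_nonneg _),
          ← ENNReal.ofReal_mul hc, ← ENNReal.ofReal_mul hc', ← ENNReal.ofReal_add (by positivity)
            (by positivity), ← ENNReal.ofReal_add (by positivity) (by positivity)]

end Expectation

end BNPL

/-! ### The main theorem -/

theorem mainTheorem4
    -- the compact data space, the data distribution, the base measure and the concentration
    {𝔛 : Type*} [MetricSpace 𝔛] [CompactSpace 𝔛] [MeasurableSpace 𝔛] [BorelSpace 𝔛]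
    (F H : Measure 𝔛) [IsProbabilityMeasure F] [IsProbabilityMeasure H]
    (a : ℝ) (ha : 0 < a)
    -- the bounded continuous kernel and its universal reproducing kernel Hilbert space
    (k : 𝔛 → 𝔛 → ℝ) (hk_cont : Continuous fun q : 𝔛 × 𝔛 => k q.1 q.2)
    (K : ℝ) (hK : ∀ x y, |k x y| < K)
    {ℋ : Type*} [NormedAddCommGroup ℋ] [InnerProductSpace ℝ ℋ] [CompleteSpace ℋ] [RKHS ℝ ℋ 𝔛 ℝ]
    (hk : BNPL.IsKernelOf k ℋ) (h_univ : BNPL.IsUniversal (𝔛 := 𝔛) ℋ)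
    -- the generators, with compact parameter domain and noise distribution `ν`
    {p t : ℕ} (ν : Measure (EuclideanSpace ℝ (Fin p))) [IsProbabilityMeasure ν]
    (Ω : Set (EuclideanSpace ℝ (Fin t))) (hΩ : IsCompact Ω)
    (Gen : Ω → EuclideanSpace ℝ (Fin p) → 𝔛)
    (hGen : Continuous fun q : Ω × EuclideanSpace ℝ (Fin p) => Gen q.1 q.2)
    -- well-specified case
    (ωTrue : Ω) (hTrue : BNPL.wmmd ℋ F (ν.map (Gen ωTrue)) = 0)
    -- data, posterior atoms, posterior weights and noise inputs on a probability space
    {S : Type*} [MeasurableSpace S] (P : Measure S) [IsProbabilityMeasure P]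
    (X : ℕ → S → 𝔛)
    (Xpos : ∀ _n N : ℕ, S → Fin N → 𝔛)
    (J : ∀ _n N : ℕ, S → Fin N → ℝ)
    (Z : ∀ _n N : ℕ, S → Fin N → EuclideanSpace ℝ (Fin p))
    (hlaw : ∀ n N : ℕ, 0 < n → 0 < N →
      HasLaw (fun s => (((fun i : Fin n => X i s), Xpos n N s), (J n N s, Z n N s)))
        (BNPL.sampleLaw F H a ν n N) P)
    -- uniform boundedness of the two Wasserstein distances
    (M : ℝ) (hM : ∀ᵐ s ∂P, ∀ n : ℕ, 0 < n →
      max (BNPL.wasserstein F (BNPL.empirical fun i : Fin n => X i s))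
        (BNPL.wasserstein F (BNPL.posteriorBase a H fun i : Fin n => X i s)) < M)
    -- the optimised parameter: a minimiser of the posterior WMMD, either with the exact generator
    -- distribution or with the empirical distribution of generated samples
    (ωstar : ∀ _n _N : ℕ, S → Ω)
    (hmeas : ∀ n N : ℕ, 0 < n → 0 < N → AEMeasurable (ωstar n N) P)
    (hmin :
      (∀ n N : ℕ, 0 < n → 0 < N → ∀ᵐ s ∂P, ∀ ω : Ω,
        BNPL.wmmd ℋ (BNPL.discreteMeasure (J n N s) (Xpos n N s)) (ν.map (Gen (ωstar n N s)))
          ≤ BNPL.wmmd ℋ (BNPL.discreteMeasure (J n N s) (Xpos n N s)) (ν.map (Gen ω))) ∨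
      (∀ n N : ℕ, 0 < n → 0 < N → ∀ᵐ s ∂P, ∀ ω : Ω,
        BNPL.wmmd ℋ (BNPL.discreteMeasure (J n N s) (Xpos n N s))
            (BNPL.empirical fun i => Gen (ωstar n N s) (Z n N s i))
          ≤ BNPL.wmmd ℋ (BNPL.discreteMeasure (J n N s) (Xpos n N s))
            (BNPL.empirical fun i => Gen ω (Z n N s i)))) :
    (∀ n N : ℕ, 0 < n → 0 < N →
      Integrable (fun s => BNPL.wmmd ℋ F (ν.map (Gen (ωstar n N s)))) P) ∧
    limsup (fun q : ℕ × ℕ =>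
      ((∫ s, BNPL.wmmd ℋ F (ν.map (Gen (ωstar q.1 q.2 s))) ∂P : ℝ) : EReal))
      (atTop ×ˢ atTop) = 0 := by
  have hφ := BNPL.continuous_kerFun (ℋ := ℋ) hk_cont hk
  have : CompactSpace Ω := isCompact_iff_compactSpace.1 hΩ
  have hGm : ∀ ω, Measurable (Gen ω) := fun ω =>
    (hGen.comp (continuous_const.prodMk continuous_id)).measurable
  have hGp : ∀ ω, IsProbabilityMeasure (ν.map (Gen ω)) := fun ω =>
    Measure.isProbabilityMeasure_map (hGm ω).aemeasurable
  have hcont := BNPL.continuous_wmmd_map hφ F ν hGen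
  have hint : ∀ n N : ℕ, 0 < n → 0 < N →
      Integrable (fun s => BNPL.wmmd ℋ F (ν.map (Gen (ωstar n N s)))) P := by
    intro n N hn hN
    obtain ⟨b, hb⟩ := (isCompact_range hcont).bddAbove
    refine Integrable.of_bound (C := b)
      (hcont.measurable.comp_aemeasurable (hmeas n N hn hN)).aestronglyMeasurable
      (ae_of_all _ fun s => ?_)
    rw [Real.norm_of_nonneg (BNPL.wmmd_nonneg _ _)]
    exact hb ⟨_, rfl⟩
  refine ⟨hint, Tendsto.limsup_eq ?_⟩
  -- The cells, and so `c`, depend on `ε` but not on `n` or `N`; this is why the two may grow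
  -- without any relation.
  have hkey : ∀ ε : ℝ, 0 < ε → ∃ c : ℝ, ∀ n N : ℕ, 0 < n → 0 < N →
      ∫ s, BNPL.wmmd ℋ F (ν.map (Gen (ωstar n N s))) ∂P ≤ ε + c * (1 / n + 1 / N) := by
    intro ε hε
    -- A one-point parameter space and the identity map compare measures on `𝔛` directly. Each `ε /
    -- 4` is doubled by the minimiser bound, for a total of `ε`.
    obtain ⟨m, A, c, hc, hA, hdata⟩ := BNPL.exists_cells_wmmd_le_sum_sq hφ (Θ := Unit)
      (T := fun _ x => x) continuous_snd F isTightMeasureSet_singleton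
      (show 0 < ε / 4 by positivity)
    obtain ⟨m', A', c', hc', hA', hnoise⟩ := BNPL.exists_cells_wmmd_le_sum_sq hφ hGen ν
      isTightMeasureSet_singleton (show 0 < ε / 4 by positivity)
    refine ⟨2 * c * m * (4 * a + 28) + 2 * c' * m', fun n N hn hN => ?_⟩
    have hcell := BNPL.integral_le_of_le_sum_sq F H ha ν hn hN (hlaw n N hn hN)
      (hint n N hn hN) (fun s => BNPL.wmmd_nonneg _ _) hA hA' hε.le
      (c := 2 * c) (c' := 2 * c') (by positivity) (by positivity) ?_
    · have hn' : (0 : ℝ) < n := by positivity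
      have hN' : (0 : ℝ) < N := by positivity
      refine hcell.trans ?_
      have h1 : 8 / (N : ℝ) + (4 * a + 20) / n ≤ (4 * a + 28) * (1 / n + 1 / N) := by
        have h1 : (0 : ℝ) ≤ 1 / n := by positivity
        have h2 : (0 : ℝ) ≤ 1 / N := by positivity
        have h3 : 8 / (N : ℝ) + (4 * a + 20) / n = 8 * (1 / N) + (4 * a + 20) * (1 / n) := by ring
        rw [h3]
        nlinarith [mul_nonneg ha.le h2]
      have h2 : 1 / (N : ℝ) ≤ 1 / n + 1 / N := by
        have : (0 : ℝ) ≤ 1 / n := by positivity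
        linarith
      have h3 := mul_le_mul_of_nonneg_left h1 (show 0 ≤ 2 * c * m by positivity)
      have h4 := mul_le_mul_of_nonneg_left h2 (show 0 ≤ 2 * c' * m' by positivity)
      linarith
    · have hsimplex : ∀ᵐ s ∂P, J n N s ∈ stdSimplex ℝ (Fin N) := by
        have h := BNPL.ae_sampleLaw_mem_stdSimplex F H ha ν hn hN
        rw [← (hlaw n N hn hN).map_eq] at h
        exact ae_of_ae_map (hlaw n N hn hN).aemeasurable h
      -- A common form for both versions of the posterior WMMD: the exact version has no sampling
      -- error and any `r ≥ 0` serves.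
      have hmin' : ∀ᵐ s ∂P, ∀ r : ℝ, 0 ≤ r →
          (∀ ω, BNPL.wmmd ℋ (BNPL.empirical fun i => Gen ω (Z n N s i)) (ν.map (Gen ω)) ≤ r) →
          BNPL.wmmd ℋ F (ν.map (Gen (ωstar n N s))) ≤
            2 * BNPL.wmmd ℋ (BNPL.discreteMeasure (J n N s) (Xpos n N s)) F + 2 * r := by
        rcases hmin with hmin | hmin
        · filter_upwards [hmin n N hn hN, hsimplex] with s hs hJ r hr _
          have := BNPL.isProbabilityMeasure_discreteMeasure hJ (Xpos n N s)
          exact BNPL.wmmd_le_of_minimiser hφ F _ (fun ω => ν.map (Gen ω))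
            (fun ω => ν.map (Gen ω)) hTrue (hs ωTrue) fun ω => by rwa [BNPL.wmmd_self]
        · filter_upwards [hmin n N hn hN, hsimplex] with s hs hJ r _ hr
          have := BNPL.isProbabilityMeasure_discreteMeasure hJ (Xpos n N s)
          have := fun ω => BNPL.isProbabilityMeasure_empirical hN fun i => Gen ω (Z n N s i)
          exact BNPL.wmmd_le_of_minimiser hφ F _ (fun ω => ν.map (Gen ω))
            (fun ω => BNPL.empirical fun i => Gen ω (Z n N s i)) hTrue (hs ωTrue) hr
      filter_upwards [hmin', hsimplex] with s hs hJ
      have := BNPL.isProbabilityMeasure_discreteMeasure hJ (Xpos n N s)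
      have := BNPL.isProbabilityMeasure_empirical hN (Z n N s)
      have h1 := hdata (BNPL.discreteMeasure (J n N s) (Xpos n N s)) ()
      rw [Measure.map_id', Measure.map_id'] at h1
      simp only [BNPL.real_discreteMeasure hJ.1 _ (hA _)] at h1
      have h2 := hs _ ?_ fun ω => by
        have h := hnoise (BNPL.empirical (Z n N s)) ω
        rw [BNPL.map_empirical _ (hGm ω)] at h
        simp only [BNPL.empirical,
          BNPL.real_discreteMeasure (BNPL.const_mem_stdSimplex hN).1 _ (hA' _)] at h
        exact h
      · linarith
      · exact add_nonneg (by positivity)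
          (mul_nonneg hc' (Finset.sum_nonneg fun i _ => sq_nonneg _))
  have hreal : Tendsto (fun q : ℕ × ℕ =>
      ∫ s, BNPL.wmmd ℋ F (ν.map (Gen (ωstar q.1 q.2 s))) ∂P) (atTop ×ˢ atTop) (𝓝 0) := by
    rw [Metric.tendsto_nhds]
    intro ε hε
    obtain ⟨c, hc⟩ := hkey (ε / 2) (by positivity)
    have hlim : Tendsto (fun q : ℕ × ℕ => ε / 2 + c * (1 / (q.1 : ℝ) + 1 / (q.2 : ℝ)))
        (atTop ×ˢ atTop) (𝓝 (ε / 2 + c * (0 + 0))) :=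
      tendsto_const_nhds.add (tendsto_const_nhds.mul
        ((tendsto_one_div_atTop_nhds_zero_nat.comp tendsto_fst).add
          (tendsto_one_div_atTop_nhds_zero_nat.comp tendsto_snd)))
    filter_upwards [hlim.eventually (gt_mem_nhds (show ε / 2 + c * (0 + 0) < ε by linarith)),
      tendsto_fst.eventually (eventually_gt_atTop 0),
      tendsto_snd.eventually (eventually_gt_atTop 0)] with q hq h1 h2
    rw [Real.dist_eq, sub_zero, abs_of_nonneg (integral_nonneg fun s => BNPL.wmmd_nonneg _ _)]
    exact (hc q.1 q.2 h1 h2).trans_lt hq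
  rw [← EReal.coe_zero]
  exact (continuous_coe_real_ereal.tendsto 0).comp hreal
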